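/- Here $A\subseteq^*B$ means that $A\setminus B$ is finite, and $A=^*B$ means $A\subseteq^*B\subseteq^*A$. A \emph{P-ideal} (of countable subsets of $\omega_1$) is a family $\mathcal I$ of countable subsets of $\omega_1$ that is closed under finite unions, under subsets, and under $=^*$ (among countable subsets of $\omega_1$), and such that for all $A_n\in\mathcal I$ ($n\in\omega$) there is $A\in\mathcal I$ with $A_n\subseteq^*A$ for every $n$. A \emph{generating sequence} for $\mathcal I$ is a sequence $\langle A_\alpha:\alpha<\omega_1\rangle$ of members of $\mathcal I$ with $A_\alpha\subseteq\alpha$, with $A_\alpha\subseteq^*A_\beta$ for $\alpha<\beta$, and such that every $A\in\mathcal I$ is included in some $A_\alpha$. Let $\kappa$ be an ordinal, $\mathbb I=\langle\mathcal I_\xi:\xi<\kappa\rangle$ a sequence of P-ideals, and for each $\xi<\kappa$ let $\langle A^\xi_\alpha:\alpha<\omega_1\rangle$ be a generating sequence for $\mathcal I_\xi$. A \emph{promise} is a function $f$ whose domain is an uncountable subset of $\omega_1$ and such that $f(\alpha)$ is a finite subset of $\alpha$ for every $\alpha\in\operatorname{dom}f$. The conditions of the notion of forcing $P(\mathbb I)$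 are the pairs $p=(a_p,\Phi_p)$ such that $a_p$ is a function from a countable subset of $\kappa\times\omega_1$ to $\{0,1\}$, the set $[p]_\xi=\{\zeta<\omega_1:a_p(\xi,\zeta)=1\}$ is in $\mathcal I_\xi$ for every $\xi<\kappa$, and $\Phi_p$ is a countable set of pairs $(v,f)$ with $v\subseteq\kappa$ finite and $f$ a promise. A condition $q$ extends $p$ (written $q\le p$) if $a_q\supseteq a_p$, $\Phi_q\supseteq\Phi_p$ and, for every $(v,f)\in\Phi_p$, the set $$Y(v,f,q,p)=\{\alpha\in\operatorname{dom}f:(\forall\xi\in v)\ [q]_\xi\setminus[p]_\xi\subseteq A^\xi_\alpha\setminus f(\alpha)\}$$ is uncountable and $(v,f\restriction Y(v,f,q,p))\in\Phi_q$. A notion of forcing $P$ (a set with its ordering) satisfies the \emph{$\aleph_2$-properness isomorphism condition} ($\aleph_2$-p.i.c.) if for every sufficiently large regular cardinal $\lambda$ the following holds. Suppose that $i<j<\omega_2$; that $N_i,N_j$ are countable elementary submodels of $(H(\lambda),\in)$ with $i\in N_i$, $j\in N_j$, $N_i\cap\omega_2\subseteq j$, $N_i\cap i=N_j\cap j$ and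 $P\in N_i\cap N_j$; that $h:N_i\to N_j$ is an isomorphism with $h(i)=j$ that is the identity on $N_i\cap N_j$; and that $p\in N_i\cap P$. Then there is $q\in P$ such that, with $\dot G$ the name of the generic set, (a) $q\Vdash(\forall r\in N_i\cap P)\,[r\in\dot G\leftrightarrow h(r)\in\dot G]$; (b) $q\Vdash p\in\dot G$; (c) $q$ is $(N_i,P)$-generic, that is, $q\Vdash\dot G\cap D\cap N_i\ne\emptyset$ for every dense $D\subseteq P$ with $D\in N_i$. \textbf{Theorem.} Assume CH. Then for every sequence $\mathbb I$ of P-ideals and every choice of generating sequences as above, $P(\mathbb I)$ satisfies the $\aleph_2$-p.i.c. -/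

import Mathlib

open scoped Cardinal Ordinal FirstOrder

universe u

noncomputable section

/-! Everything takes place in Mathlib's universe of sets `ZFSet`; ordinals are von Neumann ordinals
(`Ordinal.toZFSet`) and ordered pairs are Kuratowski pairs (`ZFSet.pair`). -/

namespace PIC

/-! ### Elementary submodels of `H(λ)` -/

/-- The only symbol of the language of set theory: a binary relation symbol for membership. -/
inductive MemRel : ℕ → Type
  | mem : MemRel 2

/-- The first-order language of set theory. -/
def setLang : FirstOrder.Language.{0, 0} := ⟨fun _ => Empty, MemRel⟩

/-- Any class of sets is an `∈`-structure. -/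
instance memStructure (M : Set ZFSet.{u}) : setLang.Structure M where
  funMap := fun f => nomatch f
  RelMap := fun {n} R =>
    match n, R with
    | 2, .mem => fun x => (x 0 : ZFSet.{u}) ∈ (x 1 : ZFSet.{u})

/-- `H(lam)`: the sets whose transitive closure has fewer than `lam` elements; equivalently, the
sets included in a transitive set with fewer than `lam` elements. -/
def H (lam : Cardinal.{u}) : Set ZFSet.{u} :=
  {x | ∃ t : ZFSet.{u}, t.IsTransitive ∧ x ⊆ t ∧ t.card < lam}

/-- Elementary submodels of `(H(lam), ∈)`. -/
abbrev Submodel (lam : Cardinal.{u}) : Type (u + 1) :=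
  setLang.ElementarySubstructure (H lam)

/-- The elements of an elementary submodel of `H(lam)`, as a class of sets. -/
def Submodel.els {lam : Cardinal.{u}} (N : Submodel lam) : Set ZFSet.{u} :=
  {x | ∃ y ∈ N, (y : ZFSet.{u}) = x}

/-- The element of `H(lam)` underlying an element of the submodel, as a set. -/
def Submodel.val {lam : Cardinal.{u}} {N : Submodel lam} (x : N) : ZFSet.{u} :=
  ((x : H lam) : ZFSet.{u})

/-! ### Notions of forcing -/

/-- A notion of forcing: a set `carrier` with a preorder on it, given as the set `rel` of the pairs
`(q, p)` such that `q` extends `p`. -/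
structure ForcingNotion where
  carrier : ZFSet.{u}
  rel : ZFSet.{u}
  rel_subset : rel ⊆ carrier.prod carrier
  refl : ∀ p ∈ carrier, ZFSet.pair p p ∈ rel
  trans : ∀ p q r, ZFSet.pair r q ∈ rel → ZFSet.pair q p ∈ rel → ZFSet.pair r p ∈ rel

namespace ForcingNotion

/-- `P.Ext q p`: the condition `q` extends `p`, that is `q ≤ p`. -/
def Ext (P : ForcingNotion.{u}) (q p : ZFSet.{u}) : Prop := ZFSet.pair q p ∈ P.rel

/-- The notion of forcing as a single set, the pair of the set of conditions and the ordering. -/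
def toZFSet (P : ForcingNotion.{u}) : ZFSet.{u} := ZFSet.pair P.carrier P.rel

/-- `D` is a dense subset of `P`. -/
def IsDense (P : ForcingNotion.{u}) (D : ZFSet.{u}) : Prop :=
  D ⊆ P.carrier ∧ ∀ p ∈ P.carrier, ∃ d ∈ D, P.Ext d p

end ForcingNotion

/-- The part of the forcing language used below: statements about the generic set `G`, built from
the atomic statements `r ∈ G` (for a set `r` of the ground model) by negation, conjunction and
universal quantification over a class of the ground model. -/
inductive GenericStatement : Type (u + 2)
  | mem (r : ZFSet.{u}) : GenericStatement
  | neg (φ : GenericStatement) : GenericStatement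
  | and (φ ψ : GenericStatement) : GenericStatement
  | all (ι : Type (u + 1)) (φ : ι → GenericStatement) : GenericStatement

namespace GenericStatement

/-- `φ ↔ ψ`, as `¬(φ ∧ ¬ψ) ∧ ¬(ψ ∧ ¬φ)`. -/
def iff (φ ψ : GenericStatement.{u}) : GenericStatement.{u} :=
  and (neg (and φ (neg ψ))) (neg (and ψ (neg φ)))

/-- `∃ i, φ i`, as `¬ ∀ i, ¬ φ i`. -/
def ex (ι : Type (u + 1)) (φ : ι → GenericStatement.{u}) : GenericStatement.{u} :=
  neg (all ι fun i => neg (φ i))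

end GenericStatement

/-- The forcing relation `q ⊩ φ`, by the usual recursion on `φ`: `q` forces `r ∈ G` if and only if
the set of extensions of `r` is dense below `q`. -/
def Forces (P : ForcingNotion.{u}) : ZFSet.{u} → GenericStatement.{u} → Prop
  | q, .mem r => ∀ s, P.Ext s q → ∃ t, P.Ext t s ∧ P.Ext t r
  | q, .neg φ => ∀ s, P.Ext s q → ¬ Forces P s φ
  | q, .and φ ψ => Forces P q φ ∧ Forces P q ψ
  | q, .all _ φ => ∀ i, Forces P q (φ i)

/-- `q` is `(N, P)`-generic: for each dense subset `D` of `P` in `N`, `q ⊩ G ∩ D ∩ N ≠ ∅`. -/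
def IsGenericCondition (P : ForcingNotion.{u}) {lam : Cardinal.{u}} (N : Submodel lam)
    (q : ZFSet.{u}) : Prop :=
  ∀ D ∈ N.els, P.IsDense D →
    Forces P q (.ex {r : ZFSet.{u} // r ∈ D ∧ r ∈ N.els} fun r => .mem r)

/-- The instance of the `ℵ₂`-properness isomorphism condition for the cardinal `lam`. -/
def SatisfiesPICAt (P : ForcingNotion.{u}) (lam : Cardinal.{u}) : Prop :=
  ∀ (i j : Ordinal.{u}) (Ni Nj : Submodel lam) (h : Ni ≃[setLang] Nj) (p : ZFSet.{u}),
    i < j → j < ω_ 2 →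
    Ni.els.Countable → Nj.els.Countable →
    i.toZFSet ∈ Ni.els → j.toZFSet ∈ Nj.els →
    -- `N_i ∩ ℵ₂ ⊆ j`
    (∀ α < ω_ 2, α.toZFSet ∈ Ni.els → α < j) →
    -- `N_i ∩ i = N_j ∩ j`
    (∀ α : Ordinal.{u}, (α.toZFSet ∈ Ni.els ∧ α < i) ↔ (α.toZFSet ∈ Nj.els ∧ α < j)) →
    -- `h(i) = j`
    (∀ x : Ni, Submodel.val x = i.toZFSet → Submodel.val (h x) = j.toZFSet) →
    -- `h` is the identity on `N_i ∩ N_j`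
    (∀ x : Ni, Submodel.val x ∈ Nj.els → Submodel.val (h x) = Submodel.val x) →
    P.toZFSet ∈ Ni.els → P.toZFSet ∈ Nj.els →
    p ∈ Ni.els → p ∈ P.carrier →
    ∃ q ∈ P.carrier,
      Forces P q (.all {r : Ni // Submodel.val r ∈ P.carrier} fun r =>
        .iff (.mem (Submodel.val r.1)) (.mem (Submodel.val (h r.1)))) ∧
      Forces P q (.mem p) ∧
      IsGenericCondition P Ni q

/-- The `ℵ₂`-properness isomorphism condition (`ℵ₂`-p.i.c.): the condition above holds for every
large enough regular cardinal. -/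
def SatisfiesAleph2PIC (P : ForcingNotion.{u}) : Prop :=
  ∃ μ : Cardinal.{u}, ∀ lam : Cardinal.{u}, μ ≤ lam → lam.IsRegular → SatisfiesPICAt P lam

/-! ### P-ideals -/

/-- The set `ω₁`. -/
def om1 : ZFSet.{u} := (ω_ 1 : Ordinal.{u}).toZFSet

/-- The set `x` is countable (finite or countably infinite). -/
def IsCountable (x : ZFSet.{u}) : Prop := (x : Set ZFSet.{u}).Countable

/-- The set `x` is finite. -/
def IsFinite (x : ZFSet.{u}) : Prop := (x : Set ZFSet.{u}).Finite

/-- `A ⊆* B`: all but finitely many elements of `A` are in `B`. -/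
def AlmostSubset (A B : ZFSet.{u}) : Prop := IsFinite (A \ B)

/-- P-ideals of countable subsets of `ω₁`. -/
structure IsPIdeal (J : ZFSet.{u}) : Prop where
  subset : ∀ A ∈ J, A ⊆ om1 ∧ IsCountable A
  union : ∀ A ∈ J, ∀ B ∈ J, A ∪ B ∈ J
  down : ∀ A ∈ J, ∀ B, B ⊆ A → B ∈ J
  almost_eq : ∀ A ∈ J, ∀ B, B ⊆ om1 → IsCountable B → AlmostSubset A B → AlmostSubset B A → B ∈ J
  pseudo_union : ∀ A : ℕ → ZFSet.{u}, (∀ n, A n ∈ J) → ∃ B ∈ J, ∀ n, AlmostSubset (A n) B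

/-- `(A α : α < ω₁)` is a generating sequence for `J`. -/
structure IsGeneratingSequence (J : ZFSet.{u}) (A : ZFSet.{u} → ZFSet.{u}) : Prop where
  mem : ∀ α ∈ om1, A α ∈ J
  subset : ∀ α ∈ om1, A α ⊆ α
  mono : ∀ β ∈ om1, ∀ α ∈ β, AlmostSubset (A α) (A β)
  cofinal : ∀ B ∈ J, ∃ α ∈ om1, B ⊆ A α

/-! ### The poset `P(𝕀)` -/

/-- `f` is a function, as a set of ordered pairs. -/
def IsFunction (f : ZFSet.{u}) : Prop :=
  (∀ z ∈ f, ∃ x y, z = ZFSet.pair x y) ∧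
    ∀ x y y', ZFSet.pair x y ∈ f → ZFSet.pair x y' ∈ f → y = y'

/-- The domain of a function. -/
def dom (f : ZFSet.{u}) : Set ZFSet.{u} := {x | ∃ y, ZFSet.pair x y ∈ f}

/-- The range of a function. -/
def ran (f : ZFSet.{u}) : Set ZFSet.{u} := {y | ∃ x, ZFSet.pair x y ∈ f}

/-- The restriction of the function `f` to `Y`. -/
def restrict (f Y : ZFSet.{u}) : ZFSet.{u} :=
  f.sep fun z => ∃ x y, z = ZFSet.pair x y ∧ x ∈ Y

/-- A promise: a function `f` whose domain is an uncountable subset of `ω₁`, such that `f(α)` is a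
finite subset of `α`. -/
structure IsPromise (f : ZFSet.{u}) : Prop where
  isFunction : IsFunction f
  dom_subset : dom f ⊆ om1
  uncountable : ¬ (dom f).Countable
  value : ∀ α w, ZFSet.pair α w ∈ f → w ⊆ α ∧ IsFinite w

/-- `[p]_ξ = {ζ < ω₁ : a_p(ξ, ζ) = 1}`, where `a = a_p`. -/
def part (a ξ : ZFSet.{u}) : ZFSet.{u} :=
  om1.sep fun ζ => ZFSet.pair (ZFSet.pair ξ ζ) {∅} ∈ a

/-- The pair `(a, Φ)` is a condition. -/
structure IsCondition (κ : Ordinal.{u}) (I : ZFSet.{u} → ZFSet.{u}) (a Φ : ZFSet.{u}) : Prop where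
  isFunction : IsFunction a
  dom_subset : dom a ⊆ κ.toZFSet.prod om1
  dom_countable : (dom a).Countable
  ran_subset : ran a ⊆ ({∅, {∅}} : ZFSet.{u})
  part_mem : ∀ ξ ∈ κ.toZFSet, part a ξ ∈ I ξ
  countable : IsCountable Φ
  promises : ∀ z ∈ Φ, ∃ v f, z = ZFSet.pair v f ∧ v ⊆ κ.toZFSet ∧ IsFinite v ∧ IsPromise f

/-- `Y(v, f, q, p) = {α ∈ dom f : ∀ ξ ∈ v, [q]_ξ \ [p]_ξ ⊆ A^ξ_α \ f(α)}`, where `b = a_q` and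
`a = a_p`. -/
def Y (A : ZFSet.{u} → ZFSet.{u} → ZFSet.{u}) (v f b a : ZFSet.{u}) : ZFSet.{u} :=
  om1.sep fun α => ∃ w, ZFSet.pair α w ∈ f ∧ ∀ ξ ∈ v, part b ξ \ part a ξ ⊆ A ξ α \ w

/-- `(b, Ψ)` extends `(a, Φ)`. -/
structure Extends (A : ZFSet.{u} → ZFSet.{u} → ZFSet.{u}) (b Ψ a Φ : ZFSet.{u}) : Prop where
  fun_subset : a ⊆ b
  promises_subset : Φ ⊆ Ψ
  keeps : ∀ v f, ZFSet.pair v f ∈ Φ →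
    ¬ IsCountable (Y A v f b a) ∧ ZFSet.pair v (restrict f (Y A v f b a)) ∈ Ψ

/-- The set of conditions of `P(𝕀)`, separated from a set that contains all of them (see
`mem_conditions`). -/
def conditions (κ : Ordinal.{u}) (I : ZFSet.{u} → ZFSet.{u}) : ZFSet.{u} :=
  ((((κ.toZFSet.prod om1).prod {∅, {∅}}).powerset).prod
    ((κ.toZFSet.powerset.prod (om1.prod om1.powerset).powerset).powerset)).sep
    fun p => ∃ a Φ, p = ZFSet.pair a Φ ∧ IsCondition κ I a Φ

theorem mem_conditions {κ : Ordinal.{u}} {I : ZFSet.{u} → ZFSet.{u}} {p : ZFSet.{u}} :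
    p ∈ conditions κ I ↔ ∃ a Φ, p = ZFSet.pair a Φ ∧ IsCondition κ I a Φ := by
  unfold conditions
  rw [ZFSet.mem_sep]
  refine ⟨And.right, fun h => ⟨?_, h⟩⟩
  obtain ⟨a, Φ, rfl, h⟩ := h
  rw [ZFSet.pair_mem_prod, ZFSet.mem_powerset, ZFSet.mem_powerset]
  refine ⟨fun z hz => ?_, fun z hz => ?_⟩
  · obtain ⟨x, y, rfl⟩ := h.isFunction.1 z hz
    exact ZFSet.pair_mem_prod.2 ⟨h.dom_subset ⟨y, hz⟩, h.ran_subset ⟨x, hz⟩⟩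
  · obtain ⟨v, f, rfl, hv, -, hf⟩ := h.promises z hz
    refine ZFSet.pair_mem_prod.2 ⟨ZFSet.mem_powerset.2 hv, ZFSet.mem_powerset.2 fun t ht => ?_⟩
    obtain ⟨x, y, rfl⟩ := hf.isFunction.1 t ht
    have hx : x ∈ om1 := hf.dom_subset ⟨y, ht⟩
    have hx' : x ⊆ om1 := (ZFSet.isOrdinal_toZFSet _).subset_of_mem hx
    exact ZFSet.pair_mem_prod.2
      ⟨hx, ZFSet.mem_powerset.2 fun s hs => hx' ((hf.value x y ht).1 hs)⟩

/-- The ordering of `P(𝕀)`: the set of the pairs `(q, p)` of conditions such that `q` extends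
`p`. -/
def ordering (κ : Ordinal.{u}) (I : ZFSet.{u} → ZFSet.{u})
    (A : ZFSet.{u} → ZFSet.{u} → ZFSet.{u}) : ZFSet.{u} :=
  ((conditions κ I).prod (conditions κ I)).sep fun z =>
    ∃ b Ψ a Φ, z = ZFSet.pair (ZFSet.pair b Ψ) (ZFSet.pair a Φ) ∧ Extends A b Ψ a Φ

theorem part_mono {a b : ZFSet.{u}} (h : a ⊆ b) (ξ : ZFSet.{u}) : part a ξ ⊆ part b ξ := by
  intro ζ hζ
  rw [part, ZFSet.mem_sep] at hζ ⊢
  exact ⟨hζ.1, h hζ.2⟩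

theorem restrict_restrict {f X Z : ZFSet.{u}} (h : Z ⊆ X) :
    restrict (restrict f X) Z = restrict f Z := by
  ext z
  simp only [restrict, ZFSet.mem_sep]
  constructor
  · rintro ⟨⟨hz, -⟩, h'⟩
    exact ⟨hz, h'⟩
  · rintro ⟨hz, x, y, rfl, hx⟩
    exact ⟨⟨hz, x, y, rfl, h hx⟩, x, y, rfl, hx⟩

theorem pair_mem_restrict {f X x y : ZFSet.{u}} :
    ZFSet.pair x y ∈ restrict f X ↔ ZFSet.pair x y ∈ f ∧ x ∈ X := by
  simp only [restrict, ZFSet.mem_sep, ZFSet.pair_inj]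
  constructor
  · rintro ⟨h, x', y', ⟨rfl, rfl⟩, hx⟩
    exact ⟨h, hx⟩
  · rintro ⟨h, hx⟩
    exact ⟨h, x, y, ⟨rfl, rfl⟩, hx⟩

theorem Y_restrict {A : ZFSet.{u} → ZFSet.{u} → ZFSet.{u}} {v f a b c : ZFSet.{u}}
    (hf : IsFunction f) (hab : a ⊆ b) (hbc : b ⊆ c) :
    Y A v (restrict f (Y A v f b a)) c b = Y A v f c a := by
  ext α
  have hY : ∀ d e : ZFSet.{u}, α ∈ Y A v f d e ↔ α ∈ om1 ∧ ∃ w, ZFSet.pair α w ∈ f ∧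
      ∀ ξ ∈ v, part d ξ \ part e ξ ⊆ A ξ α \ w := fun d e => by rw [Y, ZFSet.mem_sep]
  constructor
  · intro h
    rw [Y, ZFSet.mem_sep] at h
    obtain ⟨hα, w, hw, h1⟩ := h
    rw [pair_mem_restrict, hY] at hw
    obtain ⟨hw, -, w', hw', h2⟩ := hw
    obtain rfl := hf.2 _ _ _ hw hw'
    refine (hY _ _).2 ⟨hα, w, hw, fun ξ hξ ζ hζ => ?_⟩
    rw [ZFSet.mem_sdiff] at hζ
    by_cases hb : ζ ∈ part b ξ
    · exact h2 ξ hξ (ZFSet.mem_sdiff.2 ⟨hb, hζ.2⟩)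
    · exact h1 ξ hξ (ZFSet.mem_sdiff.2 ⟨hζ.1, hb⟩)
  · intro h
    obtain ⟨hα, w, hw, h1⟩ := (hY _ _).1 h
    rw [Y, ZFSet.mem_sep]
    refine ⟨hα, w, pair_mem_restrict.2 ⟨hw, (hY _ _).2 ⟨hα, w, hw, fun ξ hξ ζ hζ => ?_⟩⟩,
      fun ξ hξ ζ hζ => ?_⟩
    · rw [ZFSet.mem_sdiff] at hζ
      exact h1 ξ hξ (ZFSet.mem_sdiff.2 ⟨part_mono hbc ξ hζ.1, hζ.2⟩)
    · rw [ZFSet.mem_sdiff] at hζ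
      exact h1 ξ hξ (ZFSet.mem_sdiff.2 ⟨hζ.1, fun ha => hζ.2 (part_mono hab ξ ha)⟩)

theorem Y_self {A : ZFSet.{u} → ZFSet.{u} → ZFSet.{u}} {v f a : ZFSet.{u}} (hf : IsPromise f) :
    (Y A v f a a : Set ZFSet.{u}) = dom f := by
  ext α
  rw [SetLike.mem_coe, Y, ZFSet.mem_sep]
  constructor
  · rintro ⟨-, w, hw, -⟩
    exact ⟨w, hw⟩
  · rintro ⟨w, hw⟩
    refine ⟨hf.dom_subset ⟨w, hw⟩, w, hw, fun ξ _ ζ hζ => ?_⟩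
    rw [ZFSet.mem_sdiff] at hζ
    exact absurd hζ.1 hζ.2

theorem Extends.refl {κ : Ordinal.{u}} {I : ZFSet.{u} → ZFSet.{u}}
    {A : ZFSet.{u} → ZFSet.{u} → ZFSet.{u}} {a Φ : ZFSet.{u}} (h : IsCondition κ I a Φ) :
    Extends A a Φ a Φ := by
  refine ⟨fun _ hz => hz, fun _ hz => hz, fun v f hvf => ?_⟩
  obtain ⟨v', f', he, -, -, hf⟩ := h.promises _ hvf
  obtain ⟨rfl, rfl⟩ := ZFSet.pair_inj.1 he
  refine ⟨?_, ?_⟩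
  · rw [IsCountable, Y_self hf]
    exact hf.uncountable
  · have : restrict f (Y A v f a a) = f := by
      ext z
      constructor
      · intro hz
        rw [restrict, ZFSet.mem_sep] at hz
        exact hz.1
      · intro hz
        obtain ⟨x, y, rfl⟩ := hf.isFunction.1 z hz
        refine pair_mem_restrict.2 ⟨hz, ?_⟩
        rw [← SetLike.mem_coe, Y_self hf]
        exact ⟨y, hz⟩
    rwa [this]

theorem Extends.trans {κ : Ordinal.{u}} {I : ZFSet.{u} → ZFSet.{u}}
    {A : ZFSet.{u} → ZFSet.{u} → ZFSet.{u}} {a Φ b Ψ c Θ : ZFSet.{u}} (h : IsCondition κ I a Φ)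
    (hcb : Extends A c Θ b Ψ) (hba : Extends A b Ψ a Φ) : Extends A c Θ a Φ := by
  refine ⟨fun _ hz => hcb.fun_subset (hba.fun_subset hz),
    fun _ hz => hcb.promises_subset (hba.promises_subset hz), fun v f hvf => ?_⟩
  obtain ⟨v', f', he, -, -, hf⟩ := h.promises _ hvf
  obtain ⟨rfl, rfl⟩ := ZFSet.pair_inj.1 he
  have key := hcb.keeps v _ (hba.keeps v f hvf).2
  rw [Y_restrict hf.isFunction hba.fun_subset hcb.fun_subset, restrict_restrict] at key
  · exact key
  · intro α hα
    rw [← Y_restrict hf.isFunction hba.fun_subset hcb.fun_subset, Y, ZFSet.mem_sep] at hα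
    obtain ⟨-, w, hw, -⟩ := hα
    exact (pair_mem_restrict.1 hw).2

/-- The notion of forcing `P(𝕀)` for the sequence `𝕀 = (I ξ : ξ < κ)` of P-ideals with generating
sequences `(A ξ α : α < ω₁)`. -/
def idealForcing (κ : Ordinal.{u}) (I : ZFSet.{u} → ZFSet.{u})
    (A : ZFSet.{u} → ZFSet.{u} → ZFSet.{u}) : ForcingNotion.{u} where
  carrier := conditions κ I
  rel := ordering κ I A
  rel_subset := ZFSet.sep_subset
  refl := by
    intro p hp
    obtain ⟨a, Φ, rfl, h⟩ := mem_conditions.1 hp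
    rw [ordering, ZFSet.mem_sep]
    exact ⟨ZFSet.pair_mem_prod.2 ⟨hp, hp⟩, a, Φ, a, Φ, rfl, Extends.refl h⟩
  trans := by
    intro p q r hrq hqp
    rw [ordering, ZFSet.mem_sep] at hrq hqp ⊢
    obtain ⟨h1, c, Θ, b, Ψ, e1, hcb⟩ := hrq
    obtain ⟨h2, b', Ψ', a, Φ, e2, hba⟩ := hqp
    rw [ZFSet.pair_mem_prod] at h1 h2
    obtain ⟨rfl, rfl⟩ := ZFSet.pair_inj.1 e1
    obtain ⟨e3, rfl⟩ := ZFSet.pair_inj.1 e2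
    obtain ⟨rfl, rfl⟩ := ZFSet.pair_inj.1 e3
    refine ⟨ZFSet.pair_mem_prod.2 ⟨h1.1, h2.2⟩, c, Θ, a, Φ, rfl, ?_⟩
    obtain ⟨a', Φ', e4, h⟩ := mem_conditions.1 h2.2
    obtain ⟨rfl, rfl⟩ := ZFSet.pair_inj.1 e4
    exact Extends.trans h hcb hba

end PIC

end

/-! Fix isomorphic countable submodels `N` and `N'` as in the condition, with isomorphism `σ`. Both
contain `ω₁`, since `ω₁` is definable from the poset. The hypotheses on `i` and `j` then put `ω₁`
below both of them, so `N` and `N'` have the same countable ordinals and `σ` fixes these. Countable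
elements of a submodel are included in it, so for a condition `c` in `N` the part of `σ c` at `σ ξ`
is the part of `c` at `ξ`. The condition sought is a common lower bound `q` of all `p n` and all `σ
(p n)`, where `p n` is a decreasing sequence in `N`, starting at the given condition and meeting
every dense set in `N`. Such a `q` is generic. It also forces `r` and `σ r` to be in the generic set
together: some `p n` extends `r` or is incompatible with `r`, and `σ` carries either alternative
over to `σ (p n)` and `σ r`.

Two things could prevent such a `q`. First, the unions of the parts must remain in the ideals. The
parts at `ξ` of conditions in `N` belong to `I ξ`, and as parts at `σ ξ` of the images also to `I (σ
ξ)`. Intersecting a pseudo-union from each ideal gives one set `B ξ` in both that almost includes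
all these parts (`Twin.exists_pseudo_unions`). From some stage on, the part at `ξ` grows only inside
`B ξ`. Secondly, promises must be kept. If `f` is a promise with index set `v`, then for all large
`α` the sets `B ξ` with `ξ ∈ v` are included in `A ξ α` minus `f(α)` up to a finite error. There are
only countably many possible errors, so one finite set works for uncountably many `α`
(`exists_finite_keepers`). The fusion collects these finite sets and avoids them in all later growth
(`exists_fusion_sequence`, `Twin.exists_sequence`).

What makes the fusion possible is that a dense set `D` in `N` contains an extension in `N` of a
given condition whose new parts, at finitely many indices, lie inside sets `B ξ` that need not
belong to `N` (`exists_reflecting`, `Submodel.exists_small_extension`). CH lists in order type `ω₁`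
representatives of all traces on these indices of extensions in `D`. If the claim failed for
unboundedly many levels `γ`, the finite errors of `A ξ γ` against the bad sets would form a promise.
An extension in `D` of the condition with this promise added has its new parts inside one of the bad
families, and its representative appears early enough to be a contradiction. The sequence of
representatives and the level from which the claim holds are found in `N` by elementarity, and the
claim is used at the level `N ∩ ω₁`.

Only the poset is assumed to lie in the submodels, not `κ`, the ideals or the generating sequences.
All formulas therefore speak of the set of conditions and the ordering. -/

namespace PIC

/-! ### Closure properties of `H(lam)` -/

section Hereditary

variable {lam : Cardinal.{u}} {x y : ZFSet.{u}}

theorem H_of_mem (hy : y ∈ H lam) (h : x ∈ y) : x ∈ H lam := by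
  obtain ⟨t, ht, hyt, hc⟩ := hy
  exact ⟨t, ht, ht.subset_of_mem (hyt h), hc⟩

theorem H_of_subset (hy : y ∈ H lam) (h : x ⊆ y) : x ∈ H lam := by
  obtain ⟨t, ht, hyt, hc⟩ := hy
  exact ⟨t, ht, fun z hz => hyt (h hz), hc⟩

theorem H_insert (hlam : ℵ₀ ≤ lam) (hx : x ∈ H lam) (hy : y ∈ H lam) : insert x y ∈ H lam := by
  obtain ⟨t, ht, hxt, hc⟩ := hx
  obtain ⟨t', ht', hyt, hc'⟩ := hy
  refine ⟨insert x (t ∪ t'), ?_, ?_, ?_⟩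
  · intro z hz w hw
    rw [ZFSet.mem_insert_iff, ZFSet.mem_union] at hz ⊢
    rcases hz with rfl | hz | hz
    · exact .inr (.inl (hxt hw))
    · exact .inr (.inl (ht.subset_of_mem hz hw))
    · exact .inr (.inr (ht'.subset_of_mem hz hw))
  · intro z hz
    rw [ZFSet.mem_insert_iff] at hz ⊢
    rw [ZFSet.mem_union]
    exact hz.imp_right fun h => .inr (hyt h)
  · exact ZFSet.card_insert_le.trans_lt (Cardinal.add_lt_of_lt hlam
      (ZFSet.card_union_le.trans_lt (Cardinal.add_lt_of_lt hlam hc hc'))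
      (Cardinal.one_lt_aleph0.trans_le hlam))

theorem H_empty (hlam : ℵ₀ ≤ lam) : (∅ : ZFSet.{u}) ∈ H lam :=
  ⟨∅, ZFSet.isTransitive_empty, fun _ h => h, by
    rw [ZFSet.card_empty]; exact Cardinal.aleph0_pos.trans_le hlam⟩

theorem H_singleton (hlam : ℵ₀ ≤ lam) (hx : x ∈ H lam) : {x} ∈ H lam := by
  have := H_insert hlam hx (H_empty hlam)
  rwa [LawfulSingleton.insert_empty_eq] at this

theorem H_upair (hlam : ℵ₀ ≤ lam) (hx : x ∈ H lam) (hy : y ∈ H lam) : {x, y} ∈ H lam :=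
  H_insert hlam hx (H_singleton hlam hy)

theorem H_pair (hlam : ℵ₀ ≤ lam) (hx : x ∈ H lam) (hy : y ∈ H lam) : ZFSet.pair x y ∈ H lam :=
  H_upair hlam (H_singleton hlam hx) (H_upair hlam hx hy)

theorem H_of_pair_left (h : ZFSet.pair x y ∈ H lam) : x ∈ H lam := by
  have h1 : ({x} : ZFSet.{u}) ∈ ZFSet.pair x y := by simp [ZFSet.pair]
  exact H_of_mem (H_of_mem h h1) (ZFSet.mem_singleton.2 rfl)

theorem H_of_pair_right (h : ZFSet.pair x y ∈ H lam) : y ∈ H lam := by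
  have h1 : ({x, y} : ZFSet.{u}) ∈ ZFSet.pair x y := by simp [ZFSet.pair]
  exact H_of_mem (H_of_mem h h1) (by simp)

/-- Every set belongs to `H(lam)` for all large enough `lam`. -/
theorem exists_forall_mem_H (x : ZFSet.{u}) : ∃ μ : Cardinal.{u}, ∀ lam, μ ≤ lam → x ∈ H lam :=
  ⟨Order.succ (ZFSet.vonNeumann x.rank).card, fun _ h =>
    ⟨_, ZFSet.isTransitive_vonNeumann _, ZFSet.subset_vonNeumann_self x,
      (Order.lt_succ _).trans_le h⟩⟩

end Hereditary

/-! ### Definable relations on `H(lam)` -/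

/-- The membership symbol. -/
def memSymbol : setLang.Relations 2 := MemRel.mem

/-- A relation on assignments of elements of `H(lam)` is definable without parameters. -/
def Def {lam : Cardinal.{u}} (R : (ℕ → H lam) → Prop) : Prop :=
  ∃ φ : setLang.Formula ℕ, ∀ v, φ.Realize v ↔ R v

namespace Def

variable {lam : Cardinal.{u}} {R S : (ℕ → H lam) → Prop}

theorem congr (h : Def R) (hRS : ∀ v, R v ↔ S v) : Def S := by
  obtain ⟨φ, hφ⟩ := h
  exact ⟨φ, fun v => (hφ v).trans (hRS v)⟩

protected theorem mem (i j : ℕ) : Def fun v : ℕ → H lam => (v i).1 ∈ (v j).1 :=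
  ⟨FirstOrder.Language.Relations.formula₂ memSymbol (.var i) (.var j), fun v => by
    rw [FirstOrder.Language.Formula.realize_rel₂]; rfl⟩

protected theorem eq (i j : ℕ) : Def fun v : ℕ → H lam => (v i).1 = (v j).1 :=
  ⟨FirstOrder.Language.Term.equal (.var i) (.var j), fun v => by
    rw [FirstOrder.Language.Formula.realize_equal, Subtype.ext_iff]; rfl⟩

protected theorem not (h : Def R) : Def fun v => ¬ R v := by
  obtain ⟨φ, hφ⟩ := h
  exact ⟨φ.not, fun v => by rw [FirstOrder.Language.Formula.realize_not, hφ]⟩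

protected theorem and (h : Def R) (h' : Def S) : Def fun v => R v ∧ S v := by
  obtain ⟨φ, hφ⟩ := h
  obtain ⟨ψ, hψ⟩ := h'
  exact ⟨φ ⊓ ψ, fun v => by rw [FirstOrder.Language.Formula.realize_inf, hφ, hψ]⟩

protected theorem or (h : Def R) (h' : Def S) : Def fun v => R v ∨ S v := by
  obtain ⟨φ, hφ⟩ := h
  obtain ⟨ψ, hψ⟩ := h'
  exact ⟨φ ⊔ ψ, fun v => by rw [FirstOrder.Language.Formula.realize_sup, hφ, hψ]⟩

protected theorem imp (h : Def R) (h' : Def S) : Def fun v => R v → S v := by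
  obtain ⟨φ, hφ⟩ := h
  obtain ⟨ψ, hψ⟩ := h'
  exact ⟨φ.imp ψ, fun v => by rw [FirstOrder.Language.Formula.realize_imp, hφ, hψ]⟩

protected theorem iff (h : Def R) (h' : Def S) : Def fun v => (R v ↔ S v) := by
  obtain ⟨φ, hφ⟩ := h
  obtain ⟨ψ, hψ⟩ := h'
  exact ⟨φ.iff ψ, fun v => by rw [FirstOrder.Language.Formula.realize_iff, hφ, hψ]⟩

/-- The bound variable takes index 0 and the free variables are shifted by one, as with de Bruijn
indices, so nested quantifiers are handled by unification of the indices. -/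
protected theorem ex {T : (ℕ → H lam) → H lam → Prop}
    (h : Def fun v => T (fun n => v (n + 1)) (v 0)) : Def fun v => ∃ x, T v x := by
  obtain ⟨φ, hφ⟩ := h
  refine ⟨(φ.relabel fun n : ℕ => Nat.casesOn (motive := fun _ => ℕ ⊕ Unit) n (.inr ()) .inl).iExs
    Unit, fun v => ?_⟩
  rw [FirstOrder.Language.Formula.realize_iExs]
  constructor
  · rintro ⟨x, hx⟩
    rw [FirstOrder.Language.Formula.realize_relabel, hφ] at hx
    exact ⟨x (), hx⟩
  · rintro ⟨x, hx⟩
    refine ⟨fun _ => x, ?_⟩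
    rw [FirstOrder.Language.Formula.realize_relabel, hφ]
    exact hx

protected theorem all {T : (ℕ → H lam) → H lam → Prop}
    (h : Def fun v => T (fun n => v (n + 1)) (v 0)) : Def fun v => ∀ x, T v x :=
  (Def.ex (T := fun v x => ¬ T v x) h.not).not.congr fun v => by simp

/-- Quantification over all sets, when the witnesses are necessarily in `H(lam)`. -/
protected theorem exZ {T : (ℕ → H lam) → ZFSet.{u} → Prop}
    (h : Def fun v => T (fun n => v (n + 1)) (v 0).1) (hT : ∀ v x, T v x → x ∈ H lam) :
    Def fun v => ∃ x, T v x :=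
  (Def.ex (T := fun v x => T v x.1) h).congr fun v =>
    ⟨fun ⟨x, hx⟩ => ⟨x, hx⟩, fun ⟨x, hx⟩ => ⟨⟨x, hT v x hx⟩, hx⟩⟩

/-- `H lam` is transitive, so extensionality may be tested inside it. -/
theorem forall_H_iff_eq {x y : H lam} : (∀ z : H lam, z.1 ∈ x.1 ↔ z.1 ∈ y.1) ↔ x.1 = y.1 := by
  refine ⟨fun h => ZFSet.ext fun z => ⟨fun hz => ?_, fun hz => ?_⟩, fun h z => by rw [h]⟩
  · exact (h ⟨z, H_of_mem x.2 hz⟩).1 hz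
  · exact (h ⟨z, H_of_mem y.2 hz⟩).2 hz

theorem insert (hlam : ℵ₀ ≤ lam) (k i j : ℕ) :
    Def fun v : ℕ → H lam => (v k).1 = insert (v i).1 (v j).1 := by
  refine (Def.all (T := fun v z => (z.1 ∈ (v k).1 ↔ z.1 = (v i).1 ∨ z.1 ∈ (v j).1))
    ((Def.mem _ _).iff ((Def.eq _ _).or (Def.mem _ _)))).congr fun v => ?_
  rw [← forall_H_iff_eq (y := ⟨_, H_insert hlam (v i).2 (v j).2⟩)]
  simp only [ZFSet.mem_insert_iff]

theorem empty (hlam : ℵ₀ ≤ lam) (k : ℕ) : Def fun v : ℕ → H lam => (v k).1 = ∅ := by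
  refine (Def.all (T := fun v z => ¬ (z.1 ∈ (v k).1)) (Def.mem _ _).not).congr fun v => ?_
  rw [← forall_H_iff_eq (y := ⟨_, H_empty hlam⟩)]
  simp

theorem singleton (hlam : ℵ₀ ≤ lam) (k i : ℕ) :
    Def fun v : ℕ → H lam => (v k).1 = {(v i).1} := by
  refine (Def.all (T := fun v z => (z.1 ∈ (v k).1 ↔ z.1 = (v i).1))
    ((Def.mem _ _).iff (Def.eq _ _))).congr fun v => ?_
  rw [← forall_H_iff_eq (y := ⟨_, H_singleton hlam (v i).2⟩)]
  simp

theorem upair (hlam : ℵ₀ ≤ lam) (k i j : ℕ) :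
    Def fun v : ℕ → H lam => (v k).1 = {(v i).1, (v j).1} := by
  refine (Def.all (T := fun v z => (z.1 ∈ (v k).1 ↔ z.1 = (v i).1 ∨ z.1 = (v j).1))
    ((Def.mem _ _).iff ((Def.eq _ _).or (Def.eq _ _)))).congr fun v => ?_
  rw [← forall_H_iff_eq (y := ⟨_, H_upair hlam (v i).2 (v j).2⟩)]
  simp

theorem pair (hlam : ℵ₀ ≤ lam) (k i j : ℕ) :
    Def fun v : ℕ → H lam => (v k).1 = ZFSet.pair (v i).1 (v j).1 := by
  refine (Def.ex (T := fun v s => ∃ d : H lam, s.1 = {(v i).1} ∧ d.1 = {(v i).1, (v j).1} ∧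
    (v k).1 = {s.1, d.1}) (Def.ex ((singleton hlam _ _).and
      ((upair hlam _ _ _).and (upair hlam _ _ _))))).congr fun v => ?_
  constructor
  · rintro ⟨s, d, hs, hd, h⟩
    rw [h, hs, hd]; rfl
  · intro h
    exact ⟨⟨_, H_singleton hlam (v i).2⟩, ⟨_, H_upair hlam (v i).2 (v j).2⟩, rfl, rfl, h⟩

theorem pair_mem (hlam : ℵ₀ ≤ lam) (i j k : ℕ) :
    Def fun v : ℕ → H lam => ZFSet.pair (v i).1 (v j).1 ∈ (v k).1 := by
  refine (Def.ex (T := fun v z => z.1 = ZFSet.pair (v i).1 (v j).1 ∧ z.1 ∈ (v k).1)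
    ((pair hlam _ _ _).and (Def.mem _ _))).congr fun v => ?_
  constructor
  · rintro ⟨z, hz, h⟩
    rwa [← hz]
  · intro h
    exact ⟨⟨_, H_pair hlam (v i).2 (v j).2⟩, rfl, h⟩

/-! Transfer to elementary submodels. -/

variable {N N' : Submodel lam}

theorem realize_iff (φ : setLang.Formula ℕ) (v : ℕ → N) :
    φ.Realize (fun n => (v n : H lam)) ↔ φ.Realize v :=
  N.subtype.map_formula φ v

/-- The Tarski–Vaught property: an existential statement with parameters in `N` that holds in `H
lam` has a witness in `N`. -/
theorem exists_mem {T : (ℕ → H lam) → H lam → Prop}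
    (h : Def fun v => T (fun n => v (n + 1)) (v 0)) {v : ℕ → H lam} (hv : ∀ n, v n ∈ N)
    (hx : ∃ x, T v x) : ∃ x ∈ N, T v x := by
  obtain ⟨φ, hφ⟩ := h
  let ψ : setLang.Formula ℕ := (φ.relabel fun n : ℕ =>
    Nat.casesOn (motive := fun _ => ℕ ⊕ Unit) n (.inr ()) .inl).iExs Unit
  let v' : ℕ → N := fun n => ⟨v n, hv n⟩
  have h1 : ψ.Realize v := by
    rw [FirstOrder.Language.Formula.realize_iExs]
    obtain ⟨x, hx⟩ := hx
    refine ⟨fun _ => x, ?_⟩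
    rw [FirstOrder.Language.Formula.realize_relabel, hφ]
    exact hx
  have h2 : ψ.Realize v' := (realize_iff ψ v').1 h1
  rw [FirstOrder.Language.Formula.realize_iExs] at h2
  obtain ⟨x, hx⟩ := h2
  rw [FirstOrder.Language.Formula.realize_relabel, ← realize_iff, hφ] at hx
  exact ⟨x (), (x ()).2, hx⟩

theorem iso_iff (h : Def R) (g : N ≃[setLang] N') (v : ℕ → N) :
    R (fun n => (v n : H lam)) ↔ R fun n => (g (v n) : H lam) := by
  obtain ⟨φ, hφ⟩ := h
  rw [← hφ, ← hφ, realize_iff φ v, realize_iff φ fun n => g (v n)]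
  exact (FirstOrder.Language.StrongHomClass.realize_formula g φ).symm

end Def

/-! ### Coordinates of conditions -/

/-- `c = (a, Φ)` with `a(ξ, ζ) = ε`. -/
def Val (c ξ ζ ε : ZFSet.{u}) : Prop :=
  ∃ a Φ, c = ZFSet.pair a Φ ∧ ZFSet.pair (ZFSet.pair ξ ζ) ε ∈ a

/-- `c = (a, Φ)` with `(v, f) ∈ Φ`. -/
def Prm (c v f : ZFSet.{u}) : Prop :=
  ∃ a Φ, c = ZFSet.pair a Φ ∧ ZFSet.pair v f ∈ Φ

/-- The class of those `ζ` for which `c = (a, Φ)` with `a(ξ, ζ) = 1`. -/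
def pt (c ξ : ZFSet.{u}) : Set ZFSet.{u} := {ζ | Val c ξ ζ {∅}}

theorem val_pair {a Φ ξ ζ ε : ZFSet.{u}} :
    Val (ZFSet.pair a Φ) ξ ζ ε ↔ ZFSet.pair (ZFSet.pair ξ ζ) ε ∈ a := by
  constructor
  · rintro ⟨a', Φ', h, h'⟩
    obtain ⟨rfl, rfl⟩ := ZFSet.pair_inj.1 h
    exact h'
  · exact fun h => ⟨a, Φ, rfl, h⟩

theorem prm_pair {a Φ v f : ZFSet.{u}} : Prm (ZFSet.pair a Φ) v f ↔ ZFSet.pair v f ∈ Φ := by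
  constructor
  · rintro ⟨a', Φ', h, h'⟩
    obtain ⟨rfl, rfl⟩ := ZFSet.pair_inj.1 h
    exact h'
  · exact fun h => ⟨a, Φ, rfl, h⟩

/-- `α` is in the domain of some promise of some condition in `C`. -/
def InDom (C α : ZFSet.{u}) : Prop :=
  ∃ c, c ∈ C ∧ ∃ v f, Prm c v f ∧ ∃ w, ZFSet.pair α w ∈ f

/-- `w` is a value of some promise of some condition in `C`. -/
def InRan (C w : ZFSet.{u}) : Prop :=
  ∃ c, c ∈ C ∧ ∃ v f, Prm c v f ∧ ∃ α, ZFSet.pair α w ∈ f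

/-- `ξ` is an index of some promise of some condition in `C`. -/
def InIdx (C ξ : ZFSet.{u}) : Prop :=
  ∃ c, c ∈ C ∧ ∃ v f, Prm c v f ∧ ξ ∈ v

section

variable {lam : Cardinal.{u}} {c ξ ζ ε v f : ZFSet.{u}}

theorem Prm.mem_H (h : Prm c v f) (hc : c ∈ H lam) : v ∈ H lam ∧ f ∈ H lam := by
  obtain ⟨a, Φ, rfl, h⟩ := h
  have := H_of_mem (H_of_pair_right hc) h
  exact ⟨H_of_pair_left this, H_of_pair_right this⟩

theorem Val.mem_H (h : Val c ξ ζ ε) (hc : c ∈ H lam) :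
    ξ ∈ H lam ∧ ζ ∈ H lam ∧ ε ∈ H lam := by
  obtain ⟨a, Φ, rfl, h⟩ := h
  have := H_of_mem (H_of_pair_left hc) h
  have h1 := H_of_pair_left this
  exact ⟨H_of_pair_left h1, H_of_pair_right h1, H_of_pair_right this⟩

end

namespace Def

variable {lam : Cardinal.{u}}

theorem val (hlam : ℵ₀ ≤ lam) (c ξ ζ ε : ℕ) :
    Def fun v : ℕ → H lam => Val (v c).1 (v ξ).1 (v ζ).1 (v ε).1 := by
  have key : Def fun v : ℕ → H lam => ∃ a : H lam, ∃ Φ : H lam, ∃ z : H lam,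
      (v c).1 = ZFSet.pair a.1 Φ.1 ∧ z.1 = ZFSet.pair (v ξ).1 (v ζ).1 ∧
        ZFSet.pair z.1 (v ε).1 ∈ a.1 :=
    Def.ex (Def.ex (Def.ex ((pair hlam _ _ _).and ((pair hlam _ _ _).and (pair_mem hlam _ _ _)))))
  refine key.congr fun v => ?_
  constructor
  · rintro ⟨a, Φ, z, h1, h2, h3⟩
    rw [h2] at h3
    exact ⟨a, Φ, h1, h3⟩
  · rintro ⟨a, Φ, h1, h2⟩
    have := (v c).2
    rw [h1] at this
    exact ⟨⟨a, H_of_pair_left this⟩, ⟨Φ, H_of_pair_right this⟩,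
      ⟨_, H_pair hlam (v ξ).2 (v ζ).2⟩, h1, rfl, h2⟩

theorem mem_pt (hlam : ℵ₀ ≤ lam) (c ξ ζ : ℕ) :
    Def fun v : ℕ → H lam => (v ζ).1 ∈ pt (v c).1 (v ξ).1 := by
  have key : Def fun v : ℕ → H lam => ∃ e : H lam, ∃ o : H lam, o.1 = ∅ ∧ e.1 = {o.1} ∧
      Val (v c).1 (v ξ).1 (v ζ).1 e.1 :=
    Def.ex (Def.ex ((empty hlam _).and ((singleton hlam _ _).and (val hlam _ _ _ _))))
  refine key.congr fun v => ?_
  constructor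
  · rintro ⟨e, o, h1, h2, h3⟩
    rw [h2, h1] at h3
    exact h3
  · intro h
    exact ⟨⟨_, H_singleton hlam (H_empty hlam)⟩, ⟨_, H_empty hlam⟩, rfl, rfl, h⟩

theorem prm (hlam : ℵ₀ ≤ lam) (c i j : ℕ) :
    Def fun v : ℕ → H lam => Prm (v c).1 (v i).1 (v j).1 := by
  have key : Def fun v : ℕ → H lam => ∃ a : H lam, ∃ Φ : H lam,
      (v c).1 = ZFSet.pair a.1 Φ.1 ∧ ZFSet.pair (v i).1 (v j).1 ∈ Φ.1 :=
    Def.ex (Def.ex ((pair hlam _ _ _).and (pair_mem hlam _ _ _)))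
  refine key.congr fun v => ?_
  constructor
  · rintro ⟨a, Φ, h1, h2⟩
    exact ⟨a, Φ, h1, h2⟩
  · rintro ⟨a, Φ, h1, h2⟩
    have := (v c).2
    rw [h1] at this
    exact ⟨⟨a, H_of_pair_left this⟩, ⟨Φ, H_of_pair_right this⟩, h1, h2⟩

theorem inDom (hlam : ℵ₀ ≤ lam) (i j : ℕ) :
    Def fun v : ℕ → H lam => InDom (v i).1 (v j).1 := by
  have key : Def fun v : ℕ → H lam => ∃ c : H lam, c.1 ∈ (v i).1 ∧ ∃ x : H lam, ∃ f : H lam,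
      Prm c.1 x.1 f.1 ∧ ∃ w : H lam, ZFSet.pair (v j).1 w.1 ∈ f.1 :=
    Def.ex ((Def.mem _ _).and (Def.ex (Def.ex ((prm hlam _ _ _).and
      (Def.ex (pair_mem hlam _ _ _))))))
  refine key.congr fun v => ?_
  constructor
  · rintro ⟨c, h1, x, f, h2, w, h3⟩
    exact ⟨c, h1, x, f, h2, w, h3⟩
  · rintro ⟨c, h1, x, f, h2, w, h3⟩
    have hc := H_of_mem (v i).2 h1
    have hf := h2.mem_H hc
    exact ⟨⟨c, hc⟩, h1, ⟨x, hf.1⟩, ⟨f, hf.2⟩, h2, ⟨w, H_of_pair_right (H_of_mem hf.2 h3)⟩, h3⟩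

theorem inRan (hlam : ℵ₀ ≤ lam) (i j : ℕ) :
    Def fun v : ℕ → H lam => InRan (v i).1 (v j).1 := by
  have key : Def fun v : ℕ → H lam => ∃ c : H lam, c.1 ∈ (v i).1 ∧ ∃ x : H lam, ∃ f : H lam,
      Prm c.1 x.1 f.1 ∧ ∃ w : H lam, ZFSet.pair w.1 (v j).1 ∈ f.1 :=
    Def.ex ((Def.mem _ _).and (Def.ex (Def.ex ((prm hlam _ _ _).and
      (Def.ex (pair_mem hlam _ _ _))))))
  refine key.congr fun v => ?_
  constructor
  · rintro ⟨c, h1, x, f, h2, w, h3⟩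
    exact ⟨c, h1, x, f, h2, w, h3⟩
  · rintro ⟨c, h1, x, f, h2, w, h3⟩
    have hc := H_of_mem (v i).2 h1
    have hf := h2.mem_H hc
    exact ⟨⟨c, hc⟩, h1, ⟨x, hf.1⟩, ⟨f, hf.2⟩, h2, ⟨w, H_of_pair_left (H_of_mem hf.2 h3)⟩, h3⟩

theorem inIdx (hlam : ℵ₀ ≤ lam) (i j : ℕ) :
    Def fun v : ℕ → H lam => InIdx (v i).1 (v j).1 := by
  have key : Def fun v : ℕ → H lam => ∃ c : H lam, c.1 ∈ (v i).1 ∧ ∃ x : H lam, ∃ f : H lam,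
      Prm c.1 x.1 f.1 ∧ (v j).1 ∈ x.1 :=
    Def.ex ((Def.mem _ _).and (Def.ex (Def.ex ((prm hlam _ _ _).and (Def.mem _ _)))))
  refine key.congr fun v => ?_
  constructor
  · rintro ⟨c, h1, x, f, h2, h3⟩
    exact ⟨c, h1, x, f, h2, h3⟩
  · rintro ⟨c, h1, x, f, h2, h3⟩
    have hc := H_of_mem (v i).2 h1
    have hf := h2.mem_H hc
    exact ⟨⟨c, hc⟩, h1, ⟨x, hf.1⟩, ⟨f, hf.2⟩, h2, h3⟩

end Def

/-! ### Elements of elementary submodels -/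

/-- An assignment with seven prescribed values. -/
def env {M : Type*} (a b c d e f g : M) : ℕ → M
  | 0 => a
  | 1 => b
  | 2 => c
  | 3 => d
  | 4 => e
  | 5 => f
  | _ => g

theorem env_all {M : Type*} {p : M → Prop} {a b c d e f g : M} (ha : p a) (hb : p b) (hc : p c)
    (hd : p d) (he : p e) (hf : p f) (hg : p g) : ∀ n, p (env a b c d e f g n)
  | 0 => ha
  | 1 => hb
  | 2 => hc
  | 3 => hd
  | 4 => he
  | 5 => hf
  | _ + 6 => hg

namespace Submodel

variable {lam : Cardinal.{u}} {N : Submodel lam} {x y z : ZFSet.{u}}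

theorem els_iff : x ∈ N.els ↔ ∃ hx : x ∈ H lam, (⟨x, hx⟩ : H lam) ∈ N := by
  constructor
  · rintro ⟨y, hy, rfl⟩
    exact ⟨y.2, hy⟩
  · rintro ⟨hx, h⟩
    exact ⟨_, h, rfl⟩

theorem coe_mem_els {x : H lam} : x.1 ∈ N.els ↔ x ∈ N := by
  rw [els_iff]
  exact ⟨fun ⟨_, h⟩ => h, fun h => ⟨x.2, h⟩⟩

theorem H_of_els (h : x ∈ N.els) : x ∈ H lam := (els_iff.1 h).1

theorem mem_of_els (h : x ∈ N.els) : (⟨x, H_of_els h⟩ : H lam) ∈ N := (els_iff.1 h).2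

/-- A set definable from two elements of the submodel is in the submodel. -/
theorem els_of_def {T : H lam → H lam → H lam → Prop}
    (hT : Def fun v : ℕ → H lam => T (v 0) (v 1) (v 2)) {a b : ZFSet.{u}} (ha : a ∈ N.els)
    (hb : b ∈ N.els) (hx : x ∈ H lam) (h : T ⟨x, hx⟩ ⟨a, H_of_els ha⟩ ⟨b, H_of_els hb⟩)
    (hu : ∀ y, T y ⟨a, H_of_els ha⟩ ⟨b, H_of_els hb⟩ → y.1 = x) : x ∈ N.els := by
  have ha' := mem_of_els ha
  have hb' := mem_of_els hb
  obtain ⟨y, hy, h'⟩ := Def.exists_mem (N := N) (T := fun v y => T y (v 0) (v 1)) hT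
    (v := env ⟨a, H_of_els ha⟩ ⟨b, H_of_els hb⟩ ⟨b, H_of_els hb⟩ ⟨b, H_of_els hb⟩
      ⟨b, H_of_els hb⟩ ⟨b, H_of_els hb⟩ ⟨b, H_of_els hb⟩)
    (env_all (p := (· ∈ N)) ha' hb' hb' hb' hb' hb' hb') ⟨⟨x, hx⟩, h⟩
  rw [← hu y h']
  exact coe_mem_els.2 hy

theorem els_insert (hlam : ℵ₀ ≤ lam) (hx : x ∈ N.els) (hy : y ∈ N.els) : insert x y ∈ N.els :=
  els_of_def (T := fun z x y => z.1 = insert x.1 y.1) (Def.insert hlam _ _ _) hx hy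
    (H_insert hlam (H_of_els hx) (H_of_els hy)) rfl fun _ h => h

theorem els_empty (hlam : ℵ₀ ≤ lam) (hx : x ∈ N.els) : ∅ ∈ N.els :=
  els_of_def (T := fun z _ _ => z.1 = ∅) (Def.empty hlam _) hx hx (H_empty hlam) rfl fun _ h => h

theorem els_of_pair (hlam : ℵ₀ ≤ lam) (h : ZFSet.pair x y ∈ N.els) : x ∈ N.els ∧ y ∈ N.els := by
  have hx := H_of_pair_left (H_of_els h)
  have hy := H_of_pair_right (H_of_els h)
  constructor
  · refine els_of_def (T := fun z p _ => ∃ y : H lam, p.1 = ZFSet.pair z.1 y.1)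
      (Def.ex (Def.pair hlam _ _ _)) h h hx ⟨⟨y, hy⟩, rfl⟩ ?_
    rintro z ⟨w, hw⟩
    exact (ZFSet.pair_inj.1 hw).1.symm
  · refine els_of_def (T := fun z p _ => ∃ y : H lam, p.1 = ZFSet.pair y.1 z.1)
      (Def.ex (Def.pair hlam _ _ _)) h h hy ⟨⟨x, hx⟩, rfl⟩ ?_
    rintro z ⟨w, hw⟩
    exact (ZFSet.pair_inj.1 hw).2.symm

/-- If `R` is a function in the submodel, so are its values at arguments in the submodel. -/
theorem els_of_function (hlam : ℵ₀ ≤ lam) {R : ZFSet.{u}} (hR : R ∈ N.els) (hx : x ∈ N.els)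
    (hxy : ZFSet.pair x y ∈ R) (hu : ∀ y', ZFSet.pair x y' ∈ R → y' = y) : y ∈ N.els :=
  els_of_def (T := fun z R x => ZFSet.pair x.1 z.1 ∈ R.1) (Def.pair_mem hlam _ _ _) hR hx
    (H_of_pair_right (H_of_mem (H_of_els hR) hxy)) hxy fun _ hz => hu _ hz

/-- A finite collection of elements of the submodel forms an element of the submodel. -/
theorem els_of_finite (hlam : ℵ₀ ≤ lam) (hz : z ∈ N.els) {s : Set ZFSet.{u}} (hs : s.Finite)
    (hsN : s ⊆ N.els) : ∃ w ∈ N.els, (w : Set ZFSet.{u}) = s := by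
  induction s, hs using Set.Finite.induction_on with
  | empty => exact ⟨∅, els_empty hlam hz, by ext; simp⟩
  | @insert a s _ _ ih =>
    obtain ⟨w, hw, rfl⟩ := ih fun t ht => hsN (.inr ht)
    exact ⟨insert a w, els_insert hlam (hsN (.inl rfl)) hw, by ext; simp⟩

theorem H_range (hlam : lam.IsRegular) (hlam' : ℵ₀ < lam) {e : ℕ → ZFSet.{u}}
    (he : ∀ n, e n ∈ H lam) : ZFSet.range e ∈ H lam := by
  choose t ht htt hc using fun n => H_singleton hlam.aleph0_le (he n)
  refine ⟨ZFSet.iUnion t, .iUnion ht, ?_, ?_⟩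
  · intro z hz
    obtain ⟨n, rfl⟩ := ZFSet.mem_range.1 hz
    exact ZFSet.mem_iUnion.2 ⟨n, htt n (ZFSet.mem_singleton.2 rfl)⟩
  · have h1 := ZFSet.lift_card_iUnion_le_sum_card (f := t)
    rw [Cardinal.lift_id'.{0, u}] at h1
    refine h1.trans_lt (Cardinal.sum_lt_lift_of_isRegular hlam ?_ hc)
    simpa using hlam'

/-- Countable elements of an elementary submodel are included in it. -/
theorem els_of_mem_countable (hlam : lam.IsRegular) (hlam' : ℵ₀ < lam) (hx : x ∈ N.els)
    (hc : (x : Set ZFSet.{u}).Countable) (hy : y ∈ x) : y ∈ N.els := by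
  have hl := hlam.aleph0_le
  obtain ⟨e, he⟩ := hc.exists_eq_range ⟨y, hy⟩
  have hxH := H_of_els hx
  have heH : ∀ n, e n ∈ H lam := fun n => H_of_mem hxH
    (show e n ∈ (x : Set ZFSet.{u}) by rw [he]; exact ⟨n, rfl⟩)
  let o : ℕ → ZFSet.{u} := fun n => (n : Ordinal.{u}).toZFSet
  have ho : ∀ n, o (n + 1) = insert (o n) (o n) := fun n => by
    simp only [o, Nat.cast_add, Nat.cast_one, Ordinal.toZFSet_add_one]
  have hoinj : Function.Injective o := fun m n h => by
    simpa [o] using Ordinal.toZFSet_injective h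
  have hoH : ∀ n, o n ∈ H lam := fun n => by
    induction n with
    | zero => simpa [o] using H_empty hl
    | succ n ih => rw [ho]; exact H_insert hl ih ih
  -- Instead of defining `ω`, it suffices to have an index set `W` each of whose elements is empty
  -- or a successor of an element of `W`, together with a relation `g` that names each element of
  -- `x` uniquely by an element of `W`. Membership induction puts all elements of `W` into `N`.
  let T : H lam → H lam → H lam → Prop := fun x W g =>
    (∀ n : H lam, n.1 ∈ W.1 → n.1 = ∅ ∨ ∃ m : H lam, m.1 ∈ W.1 ∧ n.1 = insert m.1 m.1) ∧
      ∀ y : H lam, y.1 ∈ x.1 → ∃ n : H lam, n.1 ∈ W.1 ∧ ZFSet.pair n.1 y.1 ∈ g.1 ∧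
        ∀ y' : H lam, ZFSet.pair n.1 y'.1 ∈ g.1 → y'.1 = y.1
  have hT : ∀ i j k, Def fun v : ℕ → H lam => T (v i) (v j) (v k) := fun i j k =>
    (Def.all ((Def.mem _ _).imp ((Def.empty hl _).or
      (Def.ex ((Def.mem _ _).and (Def.insert hl _ _ _)))))).and
    (Def.all ((Def.mem _ _).imp (Def.ex ((Def.mem _ _).and ((Def.pair_mem hl _ _ _).and
      (Def.all ((Def.pair_mem hl _ _ _).imp (Def.eq _ _))))))))
  have hx' := mem_of_els hx
  obtain ⟨W, hW, h1⟩ := Def.exists_mem (N := N) (T := fun v W => ∃ g, T (v 0) W g)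
    (Def.ex (hT _ _ _)) (v := fun _ => ⟨x, hxH⟩) (fun _ => hx')
    ⟨⟨_, H_range hlam hlam' hoH⟩, ⟨_, H_range hlam hlam' fun n => H_pair hl (hoH n) (heH n)⟩, by
      constructor
      · rintro ⟨n, _⟩ hn
        obtain ⟨n, rfl⟩ := ZFSet.mem_range.1 hn
        rcases n with _ | n
        · exact .inl (by simp [o])
        · exact .inr ⟨⟨_, hoH n⟩, ZFSet.mem_range_self (f := o) n, ho n⟩
      · rintro ⟨y, hy⟩ hyx
        have : y ∈ (x : Set ZFSet.{u}) := hyx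
        rw [he] at this
        obtain ⟨n, rfl⟩ := this
        refine ⟨⟨_, hoH n⟩, ZFSet.mem_range_self (f := o) n,
          ZFSet.mem_range_self (f := fun n => ZFSet.pair (o n) (e n)) n, ?_⟩
        rintro ⟨y', _⟩ hy'
        obtain ⟨m, hm⟩ := ZFSet.mem_range.1 hy'
        obtain ⟨hmn, rfl⟩ := ZFSet.pair_inj.1 hm
        exact congrArg e (hoinj hmn)⟩
  obtain ⟨g, hg, h2, h3⟩ := Def.exists_mem (N := N) (T := fun v g => T (v 0) (v 1) g)
    (hT _ _ _) (v := env ⟨x, hxH⟩ W W W W W W) (env_all (p := (· ∈ N)) hx' hW hW hW hW hW hW) h1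
  have hWN : ∀ n, n ∈ W.1 → n ∈ N.els := fun n => by
    induction n using ZFSet.inductionOn with
    | h n ih =>
      intro hn
      rcases h2 ⟨n, H_of_mem W.2 hn⟩ hn with h | ⟨m, hm, h⟩
      · have h : n = ∅ := h
        rw [h]
        exact els_empty hl hx
      · have h : n = insert m.1 m.1 := h
        have hm' := ih m.1 (by rw [h]; exact ZFSet.mem_insert _ _) hm
        rw [h]
        exact els_insert hl hm' hm'
  obtain ⟨n, hn, hny, hu⟩ := h3 ⟨y, H_of_mem hxH hy⟩ hy
  refine els_of_function hl (coe_mem_els.2 hg) (hWN _ hn) hny fun y' hy' => ?_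
  exact hu ⟨y', H_of_pair_right (H_of_mem g.2 hy')⟩ hy'

end Submodel

/-! ### The set `ω₁` -/

theorem mem_om1 {α : ZFSet.{u}} : α ∈ om1 ↔ ∃ a < ω_ 1, a.toZFSet = α := Ordinal.mem_toZFSet_iff

theorem isOrdinal_om1 : (om1 : ZFSet.{u}).IsOrdinal := ZFSet.isOrdinal_toZFSet _

theorem mem_om1_trans {α β : ZFSet.{u}} (h : α ∈ β) (hβ : β ∈ om1) : α ∈ om1 :=
  isOrdinal_om1.mem_trans h hβ

theorem mk_om1 : #((om1 : ZFSet.{u}) : Set ZFSet.{u}) = ℵ_ 1 := by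
  have h : (om1 : ZFSet.{u}).card = ℵ_ 1 := by rw [om1, Ordinal.card_toZFSet]; simp
  refine (ZFSet.cardinalMk_coe_sort (x := (om1 : ZFSet.{u}))).trans ?_
  rw [h]; simp

theorem not_countable_om1 : ¬ ((om1 : ZFSet.{u}) : Set ZFSet.{u}).Countable := by
  rw [← Cardinal.le_aleph0_iff_set_countable, mk_om1, not_le]
  exact Cardinal.aleph0_lt_aleph_one

theorem countable_of_mem_om1 {α : ZFSet.{u}} (h : α ∈ om1) : (α : Set ZFSet.{u}).Countable := by
  obtain ⟨a, ha, rfl⟩ := mem_om1.1 h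
  rw [← Cardinal.le_aleph0_iff_set_countable]
  have := ZFSet.cardinalMk_coe_sort (x := a.toZFSet)
  rw [Ordinal.card_toZFSet] at this
  refine this.le.trans ?_
  rw [Cardinal.lift_le_aleph0]
  rw [← Cardinal.ord_aleph, Cardinal.lt_ord] at ha
  rwa [← Cardinal.lt_aleph_one_iff]

theorem countable_not_above {β : ZFSet.{u}} (hβ : β ∈ om1) :
    {α : ZFSet.{u} | α ∈ om1 ∧ β ∉ α}.Countable := by
  refine ((countable_of_mem_om1 hβ).insert β).mono ?_
  rintro α ⟨hα, h⟩
  have hα' := isOrdinal_om1.mem hα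
  have hβ' := isOrdinal_om1.mem hβ
  rw [hβ'.notMem_iff_subset hα', hα'.subset_iff_eq_or_mem hβ'] at h
  exact h

theorem exists_mem_above {s : Set ZFSet.{u}} (hs : ¬ s.Countable) (hs' : ∀ α ∈ s, α ∈ om1)
    {β : ZFSet.{u}} (hβ : β ∈ om1) : ∃ α ∈ s, β ∈ α := by
  by_contra! h
  refine hs ((countable_not_above hβ).mono fun α hα => ?_)
  exact ⟨hs' α hα, h α hα⟩

/-- If `s` were unbounded, `ω₁` would be a countable union of the countable sets of those ordinals
that are not above a given element of `s`. -/
theorem exists_upper_bound {s : Set ZFSet.{u}} (hs : s.Countable) (hs' : ∀ α ∈ s, α ∈ om1) :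
    ∃ β ∈ om1, ∀ α ∈ s, α ∈ β := by
  by_contra! h
  refine not_countable_om1 ((hs.biUnion fun α hα => countable_not_above (hs' α hα)).mono ?_)
  intro β hβ
  obtain ⟨α, hα, hαβ⟩ := h β hβ
  exact Set.mem_biUnion hα ⟨hβ, hαβ⟩

/-! ### Promises -/

/-- The restriction of `g` to `X`, as a set of pairs. -/
noncomputable def graph (X : Set ZFSet.{u}) (g : ZFSet.{u} → ZFSet.{u}) : ZFSet.{u} :=
  (om1.prod om1.powerset).sep fun z => ∃ α ∈ X, z = ZFSet.pair α (g α)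

theorem pair_mem_graph {X : Set ZFSet.{u}} {g : ZFSet.{u} → ZFSet.{u}} (hX : ∀ α ∈ X, α ∈ om1)
    (hg : ∀ α ∈ X, g α ⊆ α) {α w : ZFSet.{u}} :
    ZFSet.pair α w ∈ graph X g ↔ α ∈ X ∧ w = g α := by
  rw [graph, ZFSet.mem_sep]
  constructor
  · rintro ⟨-, β, hβ, h⟩
    obtain ⟨rfl, rfl⟩ := ZFSet.pair_inj.1 h
    exact ⟨hβ, rfl⟩
  · rintro ⟨hα, rfl⟩
    refine ⟨ZFSet.pair_mem_prod.2 ⟨hX α hα, ZFSet.mem_powerset.2 fun z hz => ?_⟩, α, hα, rfl⟩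
    exact mem_om1_trans (hg α hα hz) (hX α hα)

theorem isPromise_graph {X : Set ZFSet.{u}} {g : ZFSet.{u} → ZFSet.{u}} (hX : ∀ α ∈ X, α ∈ om1)
    (hXu : ¬ X.Countable) (hg : ∀ α ∈ X, g α ⊆ α) (hgf : ∀ α ∈ X, IsFinite (g α)) :
    IsPromise (graph X g) := by
  have key := @pair_mem_graph X g hX hg
  have hdom : dom (graph X g) = X := by
    ext α
    exact ⟨fun ⟨w, hw⟩ => (key.1 hw).1, fun h => ⟨_, key.2 ⟨h, rfl⟩⟩⟩
  refine ⟨⟨fun z hz => ?_, fun x y y' h h' => ?_⟩, ?_, ?_, fun α w h => ?_⟩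
  · rw [graph, ZFSet.mem_sep] at hz
    obtain ⟨-, α, -, h⟩ := hz
    exact ⟨_, _, h⟩
  · rw [(key.1 h).2, (key.1 h').2]
  · rw [hdom]
    exact hX
  · rwa [hdom]
  · obtain ⟨hα, rfl⟩ := key.1 h
    exact ⟨hg α hα, hgf α hα⟩

/-! ### Conditions -/

section Conditions

variable {κ : Ordinal.{u}} {I : ZFSet.{u} → ZFSet.{u}} {A : ZFSet.{u} → ZFSet.{u} → ZFSet.{u}}

theorem pair_mem_conditions {a Φ : ZFSet.{u}} :
    ZFSet.pair a Φ ∈ conditions κ I ↔ IsCondition κ I a Φ := by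
  rw [mem_conditions]
  constructor
  · rintro ⟨a', Φ', h, h'⟩
    obtain ⟨rfl, rfl⟩ := ZFSet.pair_inj.1 h
    exact h'
  · exact fun h => ⟨a, Φ, rfl, h⟩

theorem ext_pair {b Ψ a Φ : ZFSet.{u}} :
    (idealForcing κ I A).Ext (ZFSet.pair b Ψ) (ZFSet.pair a Φ) ↔
      IsCondition κ I b Ψ ∧ IsCondition κ I a Φ ∧ Extends A b Ψ a Φ := by
  change ZFSet.pair _ _ ∈ ordering κ I A ↔ _
  rw [ordering, ZFSet.mem_sep, ZFSet.pair_mem_prod,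
    pair_mem_conditions, pair_mem_conditions, and_assoc]
  refine and_congr_right fun _ => and_congr_right fun _ => ⟨?_, fun h => ⟨_, _, _, _, rfl, h⟩⟩
  rintro ⟨b', Ψ', a', Φ', h, h'⟩
  obtain ⟨h1, h2⟩ := ZFSet.pair_inj.1 h
  obtain ⟨rfl, rfl⟩ := ZFSet.pair_inj.1 h1
  obtain ⟨rfl, rfl⟩ := ZFSet.pair_inj.1 h2
  exact h'

theorem mem_carrier_of_ext {P : ForcingNotion.{u}} {q p : ZFSet.{u}} (h : P.Ext q p) :
    q ∈ P.carrier ∧ p ∈ P.carrier :=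
  ZFSet.pair_mem_prod.1 (P.rel_subset h)

theorem mem_part {a ξ ζ : ZFSet.{u}} :
    ζ ∈ part a ξ ↔ ζ ∈ om1 ∧ ZFSet.pair (ZFSet.pair ξ ζ) {∅} ∈ a := by
  rw [part, ZFSet.mem_sep]

theorem IsCondition.mem_of_pair_mem {a Φ ξ ζ ε : ZFSet.{u}} (h : IsCondition κ I a Φ)
    (h' : ZFSet.pair (ZFSet.pair ξ ζ) ε ∈ a) : ξ ∈ κ.toZFSet ∧ ζ ∈ om1 :=
  ZFSet.pair_mem_prod.1 (h.dom_subset ⟨ε, h'⟩)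

theorem IsCondition.pt_eq {a Φ : ZFSet.{u}} (h : IsCondition κ I a Φ) (ξ : ZFSet.{u}) :
    pt (ZFSet.pair a Φ) ξ = part a ξ := by
  ext ζ
  rw [SetLike.mem_coe, mem_part, pt, Set.mem_ofPred_eq, val_pair]
  exact ⟨fun h' => ⟨(h.mem_of_pair_mem h').2, h'⟩, And.right⟩

theorem IsCondition.isPromise {a Φ v f : ZFSet.{u}} (h : IsCondition κ I a Φ)
    (h' : ZFSet.pair v f ∈ Φ) : v ⊆ κ.toZFSet ∧ IsFinite v ∧ IsPromise f := by
  obtain ⟨v', f', e, h⟩ := h.promises _ h'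
  obtain ⟨rfl, rfl⟩ := ZFSet.pair_inj.1 e
  exact h

theorem isCountable_insert {x y : ZFSet.{u}} (h : IsCountable y) : IsCountable (insert x y) := by
  have : ((insert x y : ZFSet.{u}) : Set ZFSet.{u}) = insert x (y : Set ZFSet.{u}) := by
    ext; simp
  rw [IsCountable, this]
  exact h.insert x

theorem IsCondition.insert {a Φ v f : ZFSet.{u}} (h : IsCondition κ I a Φ)
    (hv : v ⊆ κ.toZFSet) (hvf : IsFinite v) (hf : IsPromise f) :
    IsCondition κ I a (insert (ZFSet.pair v f) Φ) := by
  refine { h with countable := isCountable_insert h.countable, promises := fun z hz => ?_ }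
  rw [ZFSet.mem_insert_iff] at hz
  rcases hz with rfl | hz
  · exact ⟨v, f, rfl, hv, hvf, hf⟩
  · exact h.promises z hz

theorem Extends.insert {a Φ v f : ZFSet.{u}} (h : IsCondition κ I a Φ) :
    Extends A a (insert (ZFSet.pair v f) Φ) a Φ := by
  have := Extends.refl (A := A) h
  exact ⟨fun _ hz => hz, fun _ hz => ZFSet.mem_insert_of_mem _ hz, fun v' f' h' =>
    ⟨(this.keeps v' f' h').1, ZFSet.mem_insert_of_mem _ (this.keeps v' f' h').2⟩⟩

theorem empty_mem_om1 : (∅ : ZFSet.{u}) ∈ om1 :=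
  mem_om1.2 ⟨0, by simp [Ordinal.omega_pos], by simp⟩

theorem empty_mem_ideal (hI : ∀ ξ ∈ κ.toZFSet, IsPIdeal (I ξ))
    (hA : ∀ ξ ∈ κ.toZFSet, IsGeneratingSequence (I ξ) (A ξ)) {ξ : ZFSet.{u}}
    (hξ : ξ ∈ κ.toZFSet) : ∅ ∈ I ξ :=
  (hI ξ hξ).down _ ((hA ξ hξ).mem ∅ empty_mem_om1) _ (ZFSet.empty_subset _)

end Conditions

section

variable {κ : Ordinal.{u}} {I : ZFSet.{u} → ZFSet.{u}} {A : ZFSet.{u} → ZFSet.{u} → ZFSet.{u}}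

/-! ### `ω₁`, its finite subsets and `κ` in terms of the set of conditions -/

theorem part_empty (ξ : ZFSet.{u}) : part ∅ ξ = ∅ := by
  ext ζ
  rw [mem_part]
  simp

theorem isCondition_empty (hI : ∀ ξ ∈ κ.toZFSet, IsPIdeal (I ξ))
    (hA : ∀ ξ ∈ κ.toZFSet, IsGeneratingSequence (I ξ) (A ξ)) : IsCondition κ I ∅ ∅ where
  isFunction := ⟨fun z hz => absurd hz (ZFSet.notMem_empty z),
    fun x y _ h => absurd h (ZFSet.notMem_empty _)⟩
  dom_subset := fun _ ⟨_, h⟩ => absurd h (ZFSet.notMem_empty _)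
  dom_countable := Set.countable_empty.mono fun _ ⟨_, h⟩ => absurd h (ZFSet.notMem_empty _)
  ran_subset := fun _ ⟨_, h⟩ => absurd h (ZFSet.notMem_empty _)
  part_mem := fun ξ hξ => by rw [part_empty]; exact empty_mem_ideal hI hA hξ
  countable := Set.countable_empty.mono fun z hz => absurd hz (ZFSet.notMem_empty z)
  promises := fun z hz => absurd hz (ZFSet.notMem_empty z)

theorem exists_condition_of_promise (hI : ∀ ξ ∈ κ.toZFSet, IsPIdeal (I ξ))
    (hA : ∀ ξ ∈ κ.toZFSet, IsGeneratingSequence (I ξ) (A ξ)) {v f : ZFSet.{u}}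
    (hv : v ⊆ κ.toZFSet) (hvf : IsFinite v) (hf : IsPromise f) :
    ∃ c ∈ conditions κ I, Prm c v f :=
  ⟨_, pair_mem_conditions.2 ((isCondition_empty hI hA).insert hv hvf hf),
    prm_pair.2 (ZFSet.mem_insert _ _)⟩

theorem isFinite_empty : IsFinite (∅ : ZFSet.{u}) :=
  Set.finite_empty.subset fun z hz => absurd hz (ZFSet.notMem_empty z)

theorem Prm.isPromise {c v f : ZFSet.{u}} (hc : c ∈ conditions κ I) (h : Prm c v f) :
    v ⊆ κ.toZFSet ∧ IsFinite v ∧ IsPromise f := by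
  obtain ⟨a, Φ, rfl, h'⟩ := h
  exact (pair_mem_conditions.1 hc).isPromise h'

/-- Every finite subset of `ω₁` is the constant value of a promise defined on a final segment of
`ω₁`. Finiteness can thus be expressed with the set of conditions as the only parameter. -/
theorem inRan_conditions (hI : ∀ ξ ∈ κ.toZFSet, IsPIdeal (I ξ))
    (hA : ∀ ξ ∈ κ.toZFSet, IsGeneratingSequence (I ξ) (A ξ)) {w : ZFSet.{u}} :
    InRan (conditions κ I) w ↔ IsFinite w ∧ w ⊆ om1 := by
  constructor
  · rintro ⟨c, hc, v, f, hf, α, hα⟩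
    have hf := (hf.isPromise hc).2.2
    have := hf.value _ _ hα
    exact ⟨this.2, fun z hz => mem_om1_trans (this.1 hz) (hf.dom_subset ⟨w, hα⟩)⟩
  · rintro ⟨hw, hw'⟩
    obtain ⟨β, hβ, h⟩ := exists_upper_bound hw.countable hw'
    let X : Set ZFSet.{u} := {α | α ∈ om1 ∧ β ∈ α}
    have hX : ∀ α ∈ X, α ∈ om1 := fun α hα => hα.1
    have hg : ∀ α ∈ X, w ⊆ α := fun α hα z hz => (isOrdinal_om1.mem hα.1).mem_trans (h z hz) hα.2
    have hXu : ¬ X.Countable := fun hc => not_countable_om1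
      ((hc.union (countable_not_above hβ)).mono fun α hα => by
        by_cases h : β ∈ α
        · exact .inl ⟨hα, h⟩
        · exact .inr ⟨hα, h⟩)
    obtain ⟨c, hc, hcf⟩ := exists_condition_of_promise hI hA (ZFSet.empty_subset _)
      isFinite_empty (isPromise_graph (g := fun _ => w) hX hXu hg fun _ _ => hw)
    obtain ⟨α, hα⟩ : X.Nonempty := Set.nonempty_iff_ne_empty.2 fun h =>
      hXu (by rw [h]; exact Set.countable_empty)
    exact ⟨c, hc, _, _, hcf, α, (pair_mem_graph hX hg).2 ⟨hα, rfl⟩⟩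

theorem exists_promise : ∃ f : ZFSet.{u}, IsPromise f ∧ ∀ α ∈ om1, ZFSet.pair α ∅ ∈ f :=
  ⟨graph (om1 : ZFSet.{u}) fun _ => ∅,
    isPromise_graph (fun _ h => h) not_countable_om1 (fun _ _ => ZFSet.empty_subset _)
      fun _ _ => isFinite_empty,
    fun _ hα => (pair_mem_graph (fun _ h => h) fun _ _ => ZFSet.empty_subset _).2 ⟨hα, rfl⟩⟩

theorem inDom_conditions (hI : ∀ ξ ∈ κ.toZFSet, IsPIdeal (I ξ))
    (hA : ∀ ξ ∈ κ.toZFSet, IsGeneratingSequence (I ξ) (A ξ)) {α : ZFSet.{u}} :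
    InDom (conditions κ I) α ↔ α ∈ om1 := by
  constructor
  · rintro ⟨c, hc, v, f, hf, w, hw⟩
    exact (hf.isPromise hc).2.2.dom_subset ⟨w, hw⟩
  · intro hα
    obtain ⟨f, hf, hf'⟩ := exists_promise.{u}
    obtain ⟨c, hc, hcf⟩ := exists_condition_of_promise hI hA (ZFSet.empty_subset _)
      isFinite_empty hf
    exact ⟨c, hc, _, _, hcf, ∅, hf' α hα⟩

/-- This recovers `κ` from the set of conditions, which both submodels contain, so an isomorphism
that fixes that set respects indices below `κ`. -/
theorem inIdx_conditions (hI : ∀ ξ ∈ κ.toZFSet, IsPIdeal (I ξ))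
    (hA : ∀ ξ ∈ κ.toZFSet, IsGeneratingSequence (I ξ) (A ξ)) {ξ : ZFSet.{u}} :
    InIdx (conditions κ I) ξ ↔ ξ ∈ κ.toZFSet := by
  constructor
  · rintro ⟨c, hc, v, f, hf, hξ⟩
    exact (hf.isPromise hc).1 hξ
  · intro hξ
    obtain ⟨f, hf, -⟩ := exists_promise.{u}
    obtain ⟨c, hc, hcf⟩ := exists_condition_of_promise hI hA (v := {ξ})
      (fun z hz => by rwa [ZFSet.mem_singleton.1 hz])
      ((Set.finite_singleton ξ).subset fun z hz => ZFSet.mem_singleton.1 hz) hf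
    exact ⟨c, hc, _, _, hcf, ZFSet.mem_singleton.2 rfl⟩

/-! ### Keeping promises -/

/-- The `α` in the domain of the promise `f` with `B ξ \ F ⊆ A^ξ_α \ f(α)` for all `ξ ∈ v`. -/
def keepers (A : ZFSet.{u} → ZFSet.{u} → ZFSet.{u}) (v f : ZFSet.{u})
    (B : ZFSet.{u} → Set ZFSet.{u}) (F : Set ZFSet.{u}) : Set ZFSet.{u} :=
  {α | ∃ w, ZFSet.pair α w ∈ f ∧ ∀ ξ ∈ v, ∀ ζ ∈ B ξ, ζ ∉ F → ζ ∈ A ξ α ∧ ζ ∉ w}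

theorem keepers_mono {v f : ZFSet.{u}} {B : ZFSet.{u} → Set ZFSet.{u}} {F F' : Set ZFSet.{u}}
    (h : F ⊆ F') : keepers A v f B F ⊆ keepers A v f B F' :=
  fun _ ⟨w, hw, h'⟩ => ⟨w, hw, fun ξ hξ ζ hζ hF => h' ξ hξ ζ hζ fun h'' => hF (h h'')⟩

/-- Beyond some `β`, each `A ξ α` almost includes `B ξ`, and the value of the promise at `α` is
finite, so every such `α` is a keeper for some finite subset of the countable union of the sets `B
ξ`. Only countably many such subsets exist, so one of them serves uncountably many `α`. -/
theorem exists_finite_keepers (hI : ∀ ξ ∈ κ.toZFSet, IsPIdeal (I ξ))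
    (hA : ∀ ξ ∈ κ.toZFSet, IsGeneratingSequence (I ξ) (A ξ)) {v f : ZFSet.{u}}
    (hv : v ⊆ κ.toZFSet) (hvf : IsFinite v) (hf : IsPromise f) {B : ZFSet.{u} → ZFSet.{u}}
    (hB : ∀ ξ ∈ v, B ξ ∈ I ξ) :
    ∃ F : Set ZFSet.{u}, F.Finite ∧ ¬ (keepers A v f (fun ξ => B ξ) F).Countable := by
  have h1 : ∀ ξ, ∃ β ∈ om1, ξ ∈ v → B ξ ⊆ A ξ β := fun ξ => by
    by_cases hξ : ξ ∈ v
    · obtain ⟨β, hβ, h⟩ := (hA ξ (hv hξ)).cofinal _ (hB ξ hξ)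
      exact ⟨β, hβ, fun _ => h⟩
    · exact ⟨∅, empty_mem_om1, fun h => absurd h hξ⟩
  choose b hb hb' using h1
  obtain ⟨β, hβ, hβb⟩ := exists_upper_bound (s := b '' v) (hvf.image b).countable
    (by rintro _ ⟨ξ, -, rfl⟩; exact hb ξ)
  let E : Set ZFSet.{u} := ⋃ ξ ∈ (v : Set ZFSet.{u}), (B ξ : Set ZFSet.{u})
  have hE : E.Countable := hvf.countable.biUnion fun ξ hξ =>
    ((hI ξ (hv hξ)).subset _ (hB ξ hξ)).2
  have hcount : {F : Set ZFSet.{u} | F.Finite ∧ F ⊆ E}.Countable :=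
    Set.countable_ofPred_finite_subset hE
  by_contra! hcon
  refine hf.uncountable ((((hcount.biUnion fun F hF => hcon F hF.1)).union
    (countable_not_above hβ)).mono ?_)
  rintro α ⟨w, hw⟩
  have hα := hf.dom_subset ⟨w, hw⟩
  by_cases hβα : β ∈ α
  -- The finite error at `α`: the points of the sets `B ξ` missed by `A ξ α`, and the points of
  -- their union lying in the value of the promise.
  · refine .inl (Set.mem_biUnion (x := (⋃ ξ ∈ (v : Set ZFSet.{u}),
      ((B ξ \ A ξ α : ZFSet.{u}) : Set ZFSet.{u})) ∪ ((w : Set ZFSet.{u}) ∩ E)) ⟨?_, ?_⟩ ?_)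
    · refine (hvf.biUnion fun ξ hξ => ?_).union ((hf.value _ _ hw).2.inter_of_left _)
      have h3 := (hA ξ (hv hξ)).mono α hα (b ξ)
        ((isOrdinal_om1.mem hα).mem_trans (hβb _ ⟨ξ, hξ, rfl⟩) hβα)
      refine Set.Finite.subset h3 fun ζ hζ => ?_
      rw [SetLike.mem_coe, ZFSet.mem_sdiff] at hζ ⊢
      exact ⟨hb' ξ hξ hζ.1, hζ.2⟩
    · refine Set.union_subset (Set.iUnion₂_subset fun ξ hξ ζ hζ => ?_) Set.inter_subset_right
      exact Set.mem_biUnion hξ (ZFSet.mem_sdiff.1 hζ).1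
    · refine ⟨w, hw, fun ξ hξ ζ hζ hF => ?_⟩
      have hζE : ζ ∈ E := Set.mem_biUnion (show ξ ∈ (v : Set ZFSet.{u}) from hξ) hζ
      refine ⟨?_, fun h => hF (.inr ⟨h, hζE⟩)⟩
      by_contra h
      exact hF (.inl (Set.mem_biUnion (show ξ ∈ (v : Set ZFSet.{u}) from hξ)
        (ZFSet.mem_sdiff.2 ⟨hζ, h⟩)))
  · exact .inr ⟨hα, hβα⟩

/-! ### Representatives -/

/-- Under CH, a set of size at most `ℵ₁` has at most `ℵ₁` countable subsets, so the values of `k` on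
`𝓓` inject into `ω₁`, and each value gets one chosen preimage. -/
theorem exists_representatives (hCH : Cardinal.continuum.{u} = ℵ_ 1) {G : Set ZFSet.{u}}
    (hG : #G ≤ ℵ_ 1) (𝓓 : Set ZFSet.{u}) (k : ZFSet.{u} → Set ZFSet.{u})
    (hk : ∀ d ∈ 𝓓, k d ⊆ G ∧ (k d).Countable) :
    ∃ R : ZFSet.{u} → ZFSet.{u}, ∀ d ∈ 𝓓, ∃ β ∈ om1, R β ∈ 𝓓 ∧ k (R β) = k d := by
  -- Classes of sets live one universe above the hypothesis, so CH has to be lifted.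
  have hCH' : Cardinal.continuum.{u + 1} = ℵ_ 1 := by
    have := congrArg Cardinal.lift.{u + 1, u} hCH
    simpa using this
  have h1 : #(k '' 𝓓) ≤ #((om1 : ZFSet.{u}) : Set ZFSet.{u}) := by
    rw [mk_om1]
    have h2 : k '' 𝓓 ⊆ {t | t ⊆ G ∧ #t ≤ ℵ₀} := by
      rintro _ ⟨d, hd, rfl⟩
      exact ⟨(hk d hd).1, Cardinal.le_aleph0_iff_set_countable.2 (hk d hd).2⟩
    refine (Cardinal.mk_le_mk_of_subset h2).trans ((Cardinal.mk_bounded_subset_le G ℵ₀).trans ?_)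
    calc max #G ℵ₀ ^ ℵ₀ ≤ Cardinal.continuum ^ ℵ₀ := by
          refine Cardinal.power_le_power_right (max_le ?_ Cardinal.aleph0_le_continuum)
          rw [hCH']; exact hG
      _ = ℵ_ 1 := by rw [Cardinal.continuum_power_aleph0, hCH']
  obtain ⟨ι⟩ := Cardinal.le_def _ _ |>.1 h1
  classical
  refine ⟨fun β => if h : ∃ d ∈ 𝓓, ∃ hd : k d ∈ k '' 𝓓, (ι ⟨k d, hd⟩).1 = β then h.choose else ∅,
    fun d hd => ?_⟩
  have hd' : k d ∈ k '' 𝓓 := ⟨d, hd, rfl⟩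
  have hex : ∃ d' ∈ 𝓓, ∃ hd'' : k d' ∈ k '' 𝓓, (ι ⟨k d', hd''⟩).1 = (ι ⟨k d, hd'⟩).1 :=
    ⟨d, hd, hd', rfl⟩
  refine ⟨(ι ⟨k d, hd'⟩).1, (ι ⟨k d, hd'⟩).2, ?_⟩
  simp only [dif_pos hex]
  obtain ⟨h3, h4, h5⟩ := hex.choose_spec
  exact ⟨h3, congrArg Subtype.val (ι.injective (Subtype.ext h5))⟩

theorem mk_prod_om1_le {w : ZFSet.{u}} (hw : IsFinite w) :
    #((w.prod om1 : ZFSet.{u}) : Set ZFSet.{u}) ≤ ℵ_ 1 := by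
  have h : ((w.prod om1 : ZFSet.{u}) : Set ZFSet.{u}) =
      (fun z : ZFSet.{u} × ZFSet.{u} => ZFSet.pair z.1 z.2) '' ((w : Set ZFSet.{u}) ×ˢ
        ((om1 : ZFSet.{u}) : Set ZFSet.{u})) := by
    ext z
    rw [SetLike.mem_coe, ZFSet.mem_prod]
    constructor
    · rintro ⟨a, ha, b, hb, rfl⟩
      exact ⟨(a, b), ⟨ha, hb⟩, rfl⟩
    · rintro ⟨⟨a, b⟩, ⟨ha, hb⟩, rfl⟩
      exact ⟨a, ha, b, hb, rfl⟩
  rw [h]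
  refine Cardinal.mk_image_le.trans ?_
  rw [Cardinal.mk_setProd, mk_om1]
  refine Cardinal.mul_le_of_le (Cardinal.aleph0_le_aleph 1) ?_ le_rfl
  exact (Cardinal.le_aleph0_iff_set_countable.2 hw.countable).trans (Cardinal.aleph0_le_aleph 1)

end

/-! ### Small extensions in a dense set -/

section

variable {κ : Ordinal.{u}} {I : ZFSet.{u} → ZFSet.{u}} {A : ZFSet.{u} → ZFSet.{u} → ZFSet.{u}}

/-- There is a condition whose part at each `ξ` in the finite set `w` is a given member of the
ideal. -/
theorem exists_condition_of_parts (hI : ∀ ξ ∈ κ.toZFSet, IsPIdeal (I ξ))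
    (hA : ∀ ξ ∈ κ.toZFSet, IsGeneratingSequence (I ξ) (A ξ)) {w : ZFSet.{u}}
    (hw : w ⊆ κ.toZFSet) (hwf : IsFinite w) {E : ZFSet.{u} → ZFSet.{u}}
    (hE : ∀ ξ ∈ w, E ξ ∈ I ξ) :
    ∃ c ∈ conditions κ I, ∀ ξ ∈ w, pt c ξ = E ξ := by
  let a : ZFSet.{u} := ((w.prod om1).prod {{∅}}).sep fun z =>
    ∃ ξ ζ, z = ZFSet.pair (ZFSet.pair ξ ζ) {∅} ∧ ζ ∈ E ξ
  have ha : ∀ x ε, ZFSet.pair x ε ∈ a ↔ ∃ ξ ζ, x = ZFSet.pair ξ ζ ∧ ε = {∅} ∧ ξ ∈ w ∧ ζ ∈ E ξ := by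
    intro x ε
    rw [ZFSet.mem_sep, ZFSet.pair_mem_prod]
    constructor
    · rintro ⟨⟨h1, h2⟩, ξ, ζ, h, h3⟩
      obtain ⟨rfl, rfl⟩ := ZFSet.pair_inj.1 h
      exact ⟨ξ, ζ, rfl, rfl, (ZFSet.pair_mem_prod.1 h1).1, h3⟩
    · rintro ⟨ξ, ζ, rfl, rfl, h1, h2⟩
      exact ⟨⟨ZFSet.pair_mem_prod.2 ⟨h1, ((hI ξ (hw h1)).subset _ (hE ξ h1)).1 h2⟩,
        ZFSet.mem_singleton.2 rfl⟩, ξ, ζ, rfl, h2⟩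
  have hpart : ∀ ξ ∈ w, part a ξ = E ξ := fun ξ hξ => by
    ext ζ
    rw [mem_part, ha]
    constructor
    · rintro ⟨-, ξ', ζ', h, -, -, h'⟩
      obtain ⟨rfl, rfl⟩ := ZFSet.pair_inj.1 h
      exact h'
    · intro h
      exact ⟨((hI ξ (hw hξ)).subset _ (hE ξ hξ)).1 h, ξ, ζ, rfl, rfl, hξ, h⟩
  have hc : IsCondition κ I a ∅ := by
    have he := isCondition_empty hI hA
    refine ⟨?_, ?_, ?_, ?_, ?_, he.countable, he.promises⟩
    · refine ⟨fun z hz => ?_, fun x y y' h h' => ?_⟩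
      · rw [ZFSet.mem_sep] at hz
        obtain ⟨-, ξ, ζ, h, -⟩ := hz
        exact ⟨_, _, h⟩
      · obtain ⟨-, -, -, rfl, -⟩ := (ha _ _).1 h
        obtain ⟨-, -, -, rfl, -⟩ := (ha _ _).1 h'
        rfl
    · rintro x ⟨ε, h⟩
      obtain ⟨ξ, ζ, rfl, -, h1, h2⟩ := (ha _ _).1 h
      exact ZFSet.pair_mem_prod.2 ⟨hw h1, ((hI ξ (hw h1)).subset _ (hE ξ h1)).1 h2⟩
    · refine (hwf.countable.biUnion (t := fun ξ _ => ZFSet.pair ξ '' (E ξ : Set ZFSet.{u}))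
        fun ξ hξ => (((hI ξ (hw hξ)).subset _ (hE ξ hξ)).2).image _).mono ?_
      rintro x ⟨ε, h⟩
      obtain ⟨ξ, ζ, rfl, -, h1, h2⟩ := (ha _ _).1 h
      exact Set.mem_biUnion (show ξ ∈ (w : Set ZFSet.{u}) from h1) ⟨ζ, h2, rfl⟩
    · rintro ε ⟨x, h⟩
      obtain ⟨-, -, -, rfl, -⟩ := (ha _ _).1 h
      simp
    · intro ξ hξ
      by_cases h : ξ ∈ w
      · rw [hpart ξ h]
        exact hE ξ h
      · have : part a ξ = ∅ := by
          rw [ZFSet.eq_empty]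
          intro ζ hζ
          rw [mem_part, ha] at hζ
          obtain ⟨-, ξ', ζ', h', -, h'', -⟩ := hζ
          obtain ⟨rfl, rfl⟩ := ZFSet.pair_inj.1 h'
          exact h h''
        rw [this]
        exact empty_mem_ideal hI hA hξ
  refine ⟨_, pair_mem_conditions.2 hc, fun ξ hξ => ?_⟩
  rw [hc.pt_eq, hpart ξ hξ]

/-- The combinatorial core of properness: extensions of `p` in the dense set `D` whose new parts
are small can be found in a fixed `ω₁`-sequence, before any large enough `α < ω₁`, where smallness
refers to arbitrary sets that almost contain what occurs before `α` in another fixed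
`ω₁`-sequence. -/
theorem exists_reflecting (hCH : Cardinal.continuum.{u} = ℵ_ 1)
    (hI : ∀ ξ ∈ κ.toZFSet, IsPIdeal (I ξ))
    (hA : ∀ ξ ∈ κ.toZFSet, IsGeneratingSequence (I ξ) (A ξ)) {p D w : ZFSet.{u}}
    (hp : p ∈ conditions κ I) (hD : (idealForcing κ I A).IsDense D)
    (hw : w ⊆ κ.toZFSet) (hwf : IsFinite w) :
    ∃ S R : ZFSet.{u} → ZFSet.{u}, ∃ γ ∈ om1, (∀ β ∈ om1, S β ∈ conditions κ I) ∧
      ∀ α ∈ om1, γ ∈ α → ∀ B : ZFSet.{u} → Set ZFSet.{u},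
        (∀ ξ ∈ w, ∀ β ∈ α, (pt (S β) ξ \ B ξ).Finite) →
        ∃ β ∈ α, R β ∈ D ∧ (idealForcing κ I A).Ext (R β) p ∧
          ∀ ξ ∈ w, pt (R β) ξ \ pt p ξ ⊆ B ξ := by
  -- The sets `A ξ β` are coded as parts of conditions because the generating sequences need not
  -- belong to the submodel in which `S` will be found.
  have h1 : ∀ β, ∃ c, β ∈ om1 → c ∈ conditions κ I ∧ ∀ ξ ∈ w, pt c ξ = A ξ β := fun β => by
    by_cases hβ : β ∈ om1
    · obtain ⟨c, hc, h⟩ := exists_condition_of_parts hI hA hw hwf (E := fun ξ => A ξ β)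
        fun ξ hξ => (hA ξ (hw hξ)).mem β hβ
      exact ⟨c, fun _ => ⟨hc, h⟩⟩
    · exact ⟨∅, fun h => absurd h hβ⟩
  choose S hS using h1
  -- The trace of `d` on the finitely many indices in `w`; only this matters for the conclusion, and
  -- CH bounds the number of traces.
  let k : ZFSet.{u} → Set ZFSet.{u} := fun d => {z | ∃ ξ ∈ w, ∃ ζ ∈ pt d ξ, z = ZFSet.pair ξ ζ}
  have hk : ∀ d ξ ζ, ξ ∈ w → (ZFSet.pair ξ ζ ∈ k d ↔ ζ ∈ pt d ξ) := fun d ξ ζ hξ => by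
    constructor
    · rintro ⟨ξ', -, ζ', h, e⟩
      obtain ⟨rfl, rfl⟩ := ZFSet.pair_inj.1 e
      exact h
    · exact fun h => ⟨ξ, hξ, ζ, h, rfl⟩
  obtain ⟨R, hR⟩ := exists_representatives hCH (mk_prod_om1_le hwf)
    {d | d ∈ D ∧ (idealForcing κ I A).Ext d p} k (by
      rintro d ⟨hd, -⟩
      obtain ⟨b, Ψ, rfl, hb⟩ := mem_conditions.1 (hD.1 hd)
      constructor
      · rintro z ⟨ξ, hξ, ζ, hζ, rfl⟩
        rw [hb.pt_eq] at hζ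
        exact ZFSet.pair_mem_prod.2 ⟨hξ, (mem_part.1 hζ).1⟩
      · refine (hwf.countable.biUnion (t := fun ξ _ => ZFSet.pair ξ '' pt (ZFSet.pair b Ψ) ξ)
          fun ξ hξ => ?_).mono ?_
        · rw [hb.pt_eq]
          exact ((hI ξ (hw hξ)).subset _ (hb.part_mem ξ (hw hξ))).2.image _
        · rintro z ⟨ξ, hξ, ζ, hζ, rfl⟩
          exact Set.mem_biUnion (show ξ ∈ (w : Set ZFSet.{u}) from hξ) ⟨ζ, hζ, rfl⟩)
  by_contra! hcon
  have h2 : ∀ γ : ZFSet.{u}, ∃ (α : ZFSet.{u}) (B : ZFSet.{u} → Set ZFSet.{u}), γ ∈ om1 →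
      α ∈ om1 ∧ γ ∈ α ∧ (∀ ξ ∈ w, ∀ β ∈ α, (pt (S β) ξ \ B ξ).Finite) ∧
      ∀ β ∈ α, R β ∈ D → (idealForcing κ I A).Ext (R β) p →
        ∃ ξ ∈ w, ¬ pt (R β) ξ \ pt p ξ ⊆ B ξ := fun γ => by
    by_cases hγ : γ ∈ om1
    · obtain ⟨α, hα, hγα, B, hB, h⟩ := hcon S R γ hγ fun β hβ => (hS β hβ).1
      exact ⟨α, B, fun _ => ⟨hα, hγα, hB, h⟩⟩
    · exact ⟨∅, fun _ => ∅, fun h => absurd h hγ⟩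
  choose s B hsB using h2
  -- The promise that defeats the counterexamples: `g γ` collects what `A ξ γ` has outside the bad
  -- set `B γ ξ`. It is finite since `γ` lies below the level `s γ` of its counterexample.
  let g : ZFSet.{u} → ZFSet.{u} := fun γ => γ.sep fun ζ => ∃ ξ ∈ w, ζ ∈ A ξ γ ∧ ζ ∉ B γ ξ
  have hg : ∀ γ ∈ ((om1 : ZFSet.{u}) : Set ZFSet.{u}), g γ ⊆ γ := fun γ _ => ZFSet.sep_subset
  have hf : IsPromise (graph (om1 : ZFSet.{u}) g) := by
    refine isPromise_graph (fun _ h => h) not_countable_om1 hg fun γ hγ => ?_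
    have hγ : γ ∈ om1 := hγ
    refine (hwf.biUnion (t := fun ξ => pt (S γ) ξ \ B γ ξ) fun ξ hξ =>
      (hsB γ hγ).2.2.1 ξ hξ γ (hsB γ hγ).2.1).subset fun ζ hζ => ?_
    obtain ⟨-, ξ, hξ, h, h'⟩ := ZFSet.mem_sep.1 hζ
    refine Set.mem_biUnion (show ξ ∈ (w : Set ZFSet.{u}) from hξ) ⟨?_, h'⟩
    rw [(hS γ hγ).2 ξ hξ]
    exact h
  obtain ⟨a, Φ, rfl, hap⟩ := mem_conditions.1 hp
  have hp' := hap.insert hw hwf hf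
  obtain ⟨d, hd, hdp⟩ := hD.2 _ (pair_mem_conditions.2 hp')
  obtain ⟨b, Ψ, rfl, hb⟩ := mem_conditions.1 (hD.1 hd)
  have hdp' : (idealForcing κ I A).Ext (ZFSet.pair b Ψ) (ZFSet.pair a Φ) :=
    (idealForcing κ I A).trans _ _ _ hdp (ext_pair.2 ⟨hp', hap, Extends.insert hap⟩)
  obtain ⟨β, hβ, ⟨hRD, hRp⟩, hRk⟩ := hR _ ⟨hd, hdp'⟩
  -- Uncountably many `γ` keep the promise, so one of them lies above the index `β` of the
  -- representative. For it the new parts of `d` lie in `A ξ γ` minus `g γ`, hence in `B γ ξ`, which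
  -- contradicts the choice of the counterexample at `γ`.
  have hY := ((ext_pair.1 hdp).2.2.keeps w _ (ZFSet.mem_insert _ _)).1
  obtain ⟨γ, hγ, hβγ⟩ := exists_mem_above hY
    (fun α hα => (ZFSet.mem_sep.1 (show α ∈ Y A w _ b a from hα)).1) hβ
  obtain ⟨hγ1, v, hv, hγv⟩ := ZFSet.mem_sep.1 (show γ ∈ Y A w _ b a from hγ)
  obtain ⟨-, rfl⟩ := (pair_mem_graph (fun _ h => h) hg).1 hv
  obtain ⟨hs1, hs2, -, hs4⟩ := hsB γ hγ1
  obtain ⟨ξ, hξ, hbad⟩ := hs4 β ((isOrdinal_om1.mem hs1).mem_trans hβγ hs2) hRD hRp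
  refine hbad ?_
  rintro ζ ⟨hζ, hζ'⟩
  rw [← hk _ _ _ hξ, hRk, hk _ _ _ hξ, hb.pt_eq] at hζ
  rw [hap.pt_eq] at hζ'
  have h3 := ZFSet.mem_sdiff.1 (hγv ξ hξ (ZFSet.mem_sdiff.2 ⟨hζ, hζ'⟩))
  by_contra h4
  exact h3.2 (ZFSet.mem_sep.2 ⟨(hA ξ (hw hξ)).subset γ hγ1 h3.1, ξ, hξ, h3.1, h4⟩)

end

/-! ### Fusion sequences -/

/-- Dependent choice with a growing finite set of constraints that may depend on the history. -/
theorem exists_fusion_sequence {α β : Type*} {Good : α → Prop} {Step : ℕ → Set β → α → α → Prop}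
    {G : α → α → ℕ → Set β} (hG : ∀ x y k, (G x y k).Finite)
    (hStep : ∀ m F x, Good x → F.Finite → ∃ y, Good y ∧ Step m F x y) {x₀ : α} (hx₀ : Good x₀) :
    ∃ (x : ℕ → α) (F : ℕ → Set β), x 0 = x₀ ∧ (∀ m, Good (x m)) ∧
      (∀ m, Step m (F m) (x m) (x (m + 1))) ∧ Monotone F ∧
      ∀ m, ∀ n ≤ m, ∀ k ≤ m, G (x n) (x m) k ⊆ F m := by
  choose! next hnext using hStep
  -- A state consists of the current point, the set of earlier points and the constraints gathered
  -- so far. The constraints of stage `m` are added before the next point is chosen, so that point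
  -- already respects them.
  let up : ℕ → α × Set α × Set β → Set β := fun m s =>
    s.2.2 ∪ ⋃ y ∈ insert s.1 s.2.1, ⋃ k ∈ Set.Iic m, G y s.1 k
  let st : ℕ → α × Set α × Set β := fun n => Nat.rec (x₀, ∅, ∅)
    (fun m s => (next m (up m s) s.1, insert s.1 s.2.1, up m s)) n
  have hfin : ∀ m, Good (st m).1 ∧ (st m).2.1.Finite ∧ (st m).2.2.Finite ∧
      (up m (st m)).Finite := by
    have key : ∀ m, (st m).2.1.Finite → (st m).2.2.Finite → (up m (st m)).Finite := fun m h h' =>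
      h'.union ((h.insert _).biUnion fun y _ => (Set.finite_Iic m).biUnion fun k _ => hG _ _ _)
    intro m
    induction m with
    | zero => exact ⟨hx₀, Set.finite_empty, Set.finite_empty,
        key 0 Set.finite_empty Set.finite_empty⟩
    | succ m ih =>
      have h1 : (st (m + 1)).2.1.Finite := ih.2.1.insert _
      exact ⟨(hnext m _ _ ih.1 ih.2.2.2).1, h1, ih.2.2.2, key (m + 1) h1 ih.2.2.2⟩
  have hhist : ∀ m, ∀ n ≤ m, (st n).1 ∈ insert (st m).1 (st m).2.1 := by
    intro m
    induction m with
    | zero =>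
      intro n hn
      rw [Nat.le_zero.1 hn]
      exact .inl rfl
    | succ m ih =>
      intro n hn
      rcases Nat.le_succ_iff.1 hn with h | h
      · exact .inr (ih n h)
      · rw [h]
        exact .inl rfl
  refine ⟨fun n => (st n).1, fun n => up n (st n), rfl, fun m => (hfin m).1,
    fun m => (hnext m _ _ (hfin m).1 (hfin m).2.2.2).2,
    monotone_nat_of_le_succ fun m => Set.subset_union_left, fun m n hn k hk => ?_⟩
  refine fun z hz => .inr ?_
  exact Set.mem_biUnion (hhist m n hn) (Set.mem_biUnion (show k ∈ Set.Iic m from hk) hz)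

theorem exists_coe_eq_of_countable {s : Set ZFSet.{u}} (hs : s.Countable) :
    ∃ x : ZFSet.{u}, (x : Set ZFSet.{u}) = s := by
  have := hs.to_subtype
  refine ⟨ZFSet.range (Subtype.val : s → ZFSet.{u}), ?_⟩
  ext z
  rw [SetLike.mem_coe, ZFSet.mem_range]
  exact ⟨fun ⟨i, hi⟩ => hi ▸ i.2, fun h => ⟨⟨z, h⟩, rfl⟩⟩

/-! ### Common extensions, and pairs of isomorphic models -/

section

variable {κ : Ordinal.{u}} {I : ZFSet.{u} → ZFSet.{u}} {A : ZFSet.{u} → ZFSet.{u} → ZFSet.{u}}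

theorem IsPromise.restrict_Y {v f a b : ZFSet.{u}} (hf : IsPromise f)
    (h : ¬ IsCountable (Y A v f b a)) : IsPromise (restrict f (Y A v f b a)) := by
  refine ⟨⟨fun z hz => ?_, fun x y y' h h' => ?_⟩, ?_, fun hc => h (hc.mono ?_), fun α w h => ?_⟩
  · exact hf.isFunction.1 z (ZFSet.sep_subset hz)
  · exact hf.isFunction.2 x y y' (pair_mem_restrict.1 h).1 (pair_mem_restrict.1 h').1
  · rintro α ⟨w, hw⟩
    exact hf.dom_subset ⟨w, (pair_mem_restrict.1 hw).1⟩
  · intro α hα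
    have hα : α ∈ Y A v f b a := hα
    obtain ⟨-, w, hw, -⟩ := ZFSet.mem_sep.1 hα
    exact ⟨w, pair_mem_restrict.2 ⟨hw, hα⟩⟩
  · exact hf.value α w (pair_mem_restrict.1 h).1

/-- A common extension of countably many conditions, given its first coordinate. -/
theorem exists_common_extension {ι : Type} [Countable ι] {a Φ : ι → ZFSet.{u}}
    (hc : ∀ i, IsCondition κ I (a i) (Φ i)) {b : ZFSet.{u}} (hb : IsCondition κ I b ∅)
    (hab : ∀ i, a i ⊆ b)
    (hY : ∀ i v f, ZFSet.pair v f ∈ Φ i → ¬ IsCountable (Y A v f b (a i))) :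
    ∃ Ψ, IsCondition κ I b Ψ ∧ ∀ i, Extends A b Ψ (a i) (Φ i) := by
  -- The promises of the given conditions, together with the restrictions that the ordering demands.
  let s : ι → Set ZFSet.{u} := fun i => Φ i ∪ ⋃ y ∈ (Φ i : Set ZFSet.{u}),
    {z | ∃ v f, y = ZFSet.pair v f ∧ z = ZFSet.pair v (restrict f (Y A v f b (a i)))}
  have hs : (⋃ i, s i).Countable := by
    refine Set.countable_iUnion fun i => (hc i).countable.union
      ((hc i).countable.biUnion fun y _ => Set.Subsingleton.countable ?_)
    rintro z ⟨v, f, rfl, rfl⟩ z' ⟨v', f', h, rfl⟩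
    obtain ⟨rfl, rfl⟩ := ZFSet.pair_inj.1 h
    rfl
  obtain ⟨Ψ, hΨ⟩ := exists_coe_eq_of_countable hs
  have hmem : ∀ z, z ∈ Ψ ↔ ∃ i, z ∈ s i := fun z => by
    rw [← SetLike.mem_coe, hΨ, Set.mem_iUnion]
  refine ⟨Ψ, { hb with countable := by rw [IsCountable, hΨ]; exact hs, promises := ?_ },
    fun i => ⟨hab i, fun z hz => (hmem z).2 ⟨i, .inl hz⟩, fun v f h => ⟨hY i v f h, ?_⟩⟩⟩
  · intro z hz
    obtain ⟨i, h | h⟩ := (hmem z).1 hz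
    · exact (hc i).promises z h
    · obtain ⟨y, hy, v, f, rfl, rfl⟩ := Set.mem_iUnion₂.1 h
      obtain ⟨h1, h2, h3⟩ := (hc i).isPromise hy
      exact ⟨v, _, rfl, h1, h2, h3.restrict_Y (hY i v f hy)⟩
  · exact (hmem _).2 ⟨i, .inr (Set.mem_biUnion h ⟨v, f, rfl, rfl⟩)⟩

theorem exists_coe_eq_pt {c ξ : ZFSet.{u}} (hc : c ∈ conditions κ I)
    (hξ : ξ ∈ κ.toZFSet) : ∃ x ∈ I ξ, (x : Set ZFSet.{u}) = pt c ξ := by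
  obtain ⟨a, Φ, rfl, h⟩ := mem_conditions.1 hc
  exact ⟨_, h.part_mem ξ hξ, (h.pt_eq ξ).symm⟩

/-- What a pair of isomorphic countable elementary submodels with classes of elements `N` and `N'`
and isomorphism `σ` provides for the construction of generic conditions. -/
structure Twin (κ : Ordinal.{u}) (I : ZFSet.{u} → ZFSet.{u}) (A : ZFSet.{u} → ZFSet.{u} → ZFSet.{u})
    (N N' : Set ZFSet.{u}) (σ : ZFSet.{u} → ZFSet.{u}) : Prop where
  countable : N.Countable
  inj : Set.InjOn σ N
  fixed : ∀ x ∈ N, x ∈ N' → σ x = x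
  maps : ∀ x ∈ N, σ x ∈ N'
  idx : ∀ ξ ∈ N, ξ ∈ κ.toZFSet → σ ξ ∈ κ.toZFSet
  cond : ∀ c ∈ N, c ∈ conditions κ I → σ c ∈ conditions κ I
  val : ∀ c ∈ N, c ∈ conditions κ I → ∀ ξ ∈ N, ∀ ζ ε, Val (σ c) (σ ξ) ζ ε ↔ Val c ξ ζ ε
  supp : ∀ c ∈ N, c ∈ conditions κ I → ∀ ξ ζ ε, Val c ξ ζ ε → ξ ∈ N
  supp' : ∀ c ∈ N, c ∈ conditions κ I → ∀ ξ ζ ε, Val (σ c) ξ ζ ε →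
    ∃ η ∈ N, η ∈ κ.toZFSet ∧ σ η = ξ
  prm : ∀ c ∈ N, c ∈ conditions κ I → ∀ v f, Prm c v f → ZFSet.pair v f ∈ N ∧ ∀ ξ ∈ v, ξ ∈ N
  prm' : ∀ c ∈ N, c ∈ conditions κ I → ∀ v f, Prm (σ c) v f →
    (∃ z ∈ N, σ z = ZFSet.pair v f) ∧ ∀ ξ ∈ v, ∃ η ∈ N, η ∈ κ.toZFSet ∧ σ η = ξ
  ext : ∀ p ∈ N, ∀ q ∈ N, (idealForcing κ I A).Ext q p → (idealForcing κ I A).Ext (σ q) (σ p)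
  compat : ∀ p ∈ N, ∀ r ∈ N, ∀ e, (idealForcing κ I A).Ext e (σ p) →
    (idealForcing κ I A).Ext e (σ r) →
    ∃ e, (idealForcing κ I A).Ext e p ∧ (idealForcing κ I A).Ext e r
  decide : ∀ r ∈ N, r ∈ conditions κ I → ∃ D ∈ N, (idealForcing κ I A).IsDense D ∧
    ∀ d ∈ D, (idealForcing κ I A).Ext d r ∨
      ∀ e, (idealForcing κ I A).Ext e d → ¬ (idealForcing κ I A).Ext e r
  next : ∀ p ∈ N, p ∈ conditions κ I → ∀ D ∈ N, (idealForcing κ I A).IsDense D →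
    ∀ w : Set ZFSet.{u}, w.Finite → (∀ ξ ∈ w, ξ ∈ N ∧ ξ ∈ κ.toZFSet) →
    ∀ B : ZFSet.{u} → Set ZFSet.{u},
      (∀ c ∈ N, c ∈ conditions κ I → ∀ ξ ∈ w, (pt c ξ \ B ξ).Finite) →
      ∃ d ∈ N, d ∈ D ∧ (idealForcing κ I A).Ext d p ∧ ∀ ξ ∈ w, pt d ξ \ pt p ξ ⊆ B ξ

namespace Twin

variable {N N' : Set ZFSet.{u}} {σ : ZFSet.{u} → ZFSet.{u}}

theorem pt_eq (T : Twin κ I A N N' σ) {c ξ : ZFSet.{u}} (hc : c ∈ N) (hc' : c ∈ conditions κ I)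
    (hξ : ξ ∈ N) : pt (σ c) (σ ξ) = pt c ξ := by
  ext ζ
  exact T.val c hc hc' ξ hξ ζ _

/-- A set in both ideals `I ξ` and `I (σ ξ)` that almost includes the parts at `ξ` of all the
conditions in `N`. -/
theorem exists_pseudo_union (T : Twin κ I A N N' σ) (hI : ∀ ξ ∈ κ.toZFSet, IsPIdeal (I ξ))
    (hA : ∀ ξ ∈ κ.toZFSet, IsGeneratingSequence (I ξ) (A ξ)) {ξ : ZFSet.{u}} (hξ : ξ ∈ N)
    (hξκ : ξ ∈ κ.toZFSet) :
    ∃ B ∈ I ξ, B ∈ I (σ ξ) ∧ ∀ c ∈ N, c ∈ conditions κ I → (pt c ξ \ B).Finite := by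
  have hξκ' := T.idx ξ hξ hξκ
  have key : ∀ η ∈ κ.toZFSet, (∀ c ∈ N, c ∈ conditions κ I → ∃ x ∈ I η,
      (x : Set ZFSet.{u}) = pt c ξ) → ∃ B ∈ I η, ∀ c ∈ N, c ∈ conditions κ I →
        (pt c ξ \ B).Finite := fun η hη h => by
    rcases N.eq_empty_or_nonempty with h0 | h0
    · exact ⟨∅, empty_mem_ideal hI hA hη, fun c hc => by rw [h0] at hc; exact absurd hc (by simp)⟩
    obtain ⟨x, hx⟩ := T.countable.exists_eq_range h0
    have h1 : ∀ n, ∃ y ∈ I η, x n ∈ conditions κ I → (y : Set ZFSet.{u}) = pt (x n) ξ := fun n => by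
      by_cases hn : x n ∈ conditions κ I
      · obtain ⟨y, hy, h2⟩ := h (x n) (hx ▸ ⟨n, rfl⟩) hn
        exact ⟨y, hy, fun _ => h2⟩
      · exact ⟨∅, empty_mem_ideal hI hA hη, fun h => absurd h hn⟩
    choose y hy hy' using h1
    obtain ⟨B, hB, h2⟩ := (hI η hη).pseudo_union y hy
    refine ⟨B, hB, fun c hc hc' => ?_⟩
    rw [hx] at hc
    obtain ⟨n, rfl⟩ := hc
    rw [← hy' n hc']
    refine Set.Finite.subset (h2 n) fun ζ hζ => ?_
    exact ZFSet.mem_sdiff.2 hζ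
  -- The same parts generate countable families in two ideals, one at `ξ` and one at `σ ξ`. The
  -- intersection of the two pseudo-unions lies in both ideals and still almost includes every part.
  obtain ⟨B₀, hB₀, h₀⟩ := key ξ hξκ fun c _ hc' => exists_coe_eq_pt hc' hξκ
  obtain ⟨B₁, hB₁, h₁⟩ := key (σ ξ) hξκ' fun c hc hc' => by
    rw [← T.pt_eq hc hc' hξ]
    exact exists_coe_eq_pt (T.cond c hc hc') hξκ'
  refine ⟨B₀ ∩ B₁, (hI ξ hξκ).down _ hB₀ _ fun z hz => (ZFSet.mem_inter.1 hz).1,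
    (hI _ hξκ').down _ hB₁ _ fun z hz => (ZFSet.mem_inter.1 hz).2, fun c hc hc' => ?_⟩
  refine ((h₀ c hc hc').union (h₁ c hc hc')).subset ?_
  rintro ζ ⟨hζ, hζ'⟩
  by_cases h : ζ ∈ B₀
  · exact .inr ⟨hζ, fun h' => hζ' (ZFSet.mem_inter.2 ⟨h, h'⟩)⟩
  · exact .inl ⟨hζ, h⟩

theorem exists_pseudo_unions (T : Twin κ I A N N' σ) (hI : ∀ ξ ∈ κ.toZFSet, IsPIdeal (I ξ))
    (hA : ∀ ξ ∈ κ.toZFSet, IsGeneratingSequence (I ξ) (A ξ)) :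
    ∃ B : ZFSet.{u} → ZFSet.{u}, ∀ η ∈ N, η ∈ κ.toZFSet → B (σ η) = B η ∧ B η ∈ I η ∧
      B η ∈ I (σ η) ∧ ∀ c ∈ N, c ∈ conditions κ I → (pt c η \ B η).Finite := by
  have h1 : ∀ ξ, ∃ B, ξ ∈ N → ξ ∈ κ.toZFSet → B ∈ I ξ ∧ B ∈ I (σ ξ) ∧
      ∀ c ∈ N, c ∈ conditions κ I → (pt c ξ \ B).Finite := fun ξ => by
    by_cases h : ξ ∈ N ∧ ξ ∈ κ.toZFSet
    · obtain ⟨B, h1, h2, h3⟩ := T.exists_pseudo_union hI hA h.1 h.2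
      exact ⟨B, fun _ _ => ⟨h1, h2, h3⟩⟩
    · exact ⟨∅, fun h1 h2 => absurd ⟨h1, h2⟩ h⟩
  choose B hB using h1
  classical
  -- An element of `N` that is also an image lies in both models, hence is fixed, and injectivity
  -- makes it its own preimage. So the value of `B` at an image is well defined.
  have h2 : ∀ ξ ∈ N, ∀ η ∈ N, σ η = ξ → η = ξ := by
    rintro _ hξ η hη rfl
    exact (T.inj hξ hη (T.fixed _ hξ (T.maps η hη))).symm
  refine ⟨fun ξ => if ξ ∈ N then B ξ else if h : ∃ η ∈ N, σ η = ξ then B h.choose else ∅,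
    fun η hη hηκ => ?_⟩
  have h3 : (if σ η ∈ N then B (σ η) else if h : ∃ η' ∈ N, σ η' = σ η then B h.choose else ∅) =
      B η := by
    by_cases hN : σ η ∈ N
    · rw [if_pos hN, ← h2 _ hN η hη rfl]
    · have h : ∃ η' ∈ N, σ η' = σ η := ⟨η, hη, rfl⟩
      rw [if_neg hN, dif_pos h, T.inj h.choose_spec.1 hη h.choose_spec.2]
  simp only [if_pos hη]
  exact ⟨h3, hB η hη hηκ⟩

end Twin

end

/-! ### The fusion for a pair of isomorphic models -/

variable {κ : Ordinal.{u}} {I : ZFSet.{u} → ZFSet.{u}} {A : ZFSet.{u} → ZFSet.{u} → ZFSet.{u}}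

theorem val_mono {p q ξ ζ ε : ZFSet.{u}} (h : (idealForcing κ I A).Ext q p) (hv : Val p ξ ζ ε) :
    Val q ξ ζ ε := by
  obtain ⟨h1, h2⟩ := mem_carrier_of_ext h
  obtain ⟨b, Ψ, rfl, hb⟩ := mem_conditions.1 h1
  obtain ⟨a, Φ, rfl, ha⟩ := mem_conditions.1 h2
  rw [val_pair] at hv ⊢
  exact (ext_pair.1 h).2.2.fun_subset hv

namespace Twin

variable {N N' : Set ZFSet.{u}} {σ : ZFSet.{u} → ZFSet.{u}}

/-- A decreasing sequence of conditions in `N` that meets all the dense sets in `N`, whose parts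
grow inside the sets `B ξ`, and along which all promises, also those of the images under `σ`, can
be kept. -/
theorem exists_sequence (T : Twin κ I A N N' σ) (hI : ∀ ξ ∈ κ.toZFSet, IsPIdeal (I ξ))
    (hA : ∀ ξ ∈ κ.toZFSet, IsGeneratingSequence (I ξ) (A ξ)) {B : ZFSet.{u} → ZFSet.{u}}
    (hB : ∀ η ∈ N, η ∈ κ.toZFSet → ∀ c ∈ N, c ∈ conditions κ I → (pt c η \ B η).Finite)
    {x : ℕ → ZFSet.{u}} (hx : N = Set.range x) {p₀ : ZFSet.{u}} (hp₀ : p₀ ∈ N)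
    (hp₀' : p₀ ∈ conditions κ I) :
    ∃ (p : ℕ → ZFSet.{u}) (F : ℕ → Set ZFSet.{u}), p 0 = p₀ ∧
      (∀ m, p m ∈ N ∧ p m ∈ conditions κ I) ∧
      (∀ m, (idealForcing κ I A).Ext (p (m + 1)) (p m)) ∧
      (∀ m, (idealForcing κ I A).IsDense (x m) → p (m + 1) ∈ x m) ∧
      (∀ m, ∀ k < m, x k ∈ κ.toZFSet →
        pt (p (m + 1)) (x k) \ pt (p m) (x k) ⊆ (B (x k) : Set ZFSet.{u}) \ F m) ∧
      Monotone F ∧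
      ∀ τ : ZFSet.{u} → ZFSet.{u}, τ = id ∨ τ = σ → ∀ m, ∀ n ≤ m, ∀ k ≤ m, ∀ a Φ b Ψ v f,
        τ (p n) = ZFSet.pair a Φ → τ (p m) = ZFSet.pair b Ψ → τ (x k) = ZFSet.pair v f →
        v ⊆ κ.toZFSet → IsFinite v → IsPromise (restrict f (Y A v f b a)) →
        (∀ ξ ∈ v, B ξ ∈ I ξ) →
        ¬ (keepers A v (restrict f (Y A v f b a)) (fun ξ => B ξ) (F m)).Countable := by
  -- The finite set for a promise coded by `z`, after restriction to the points that keep it on the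
  -- way from `c` to `d`. Triples that do not code such a situation get the empty set.
  have hG : ∀ c d z : ZFSet.{u}, ∃ F : Set ZFSet.{u}, F.Finite ∧ ∀ a Φ b Ψ v f,
      c = ZFSet.pair a Φ → d = ZFSet.pair b Ψ → z = ZFSet.pair v f →
      v ⊆ κ.toZFSet → IsFinite v → IsPromise (restrict f (Y A v f b a)) →
      (∀ ξ ∈ v, B ξ ∈ I ξ) →
      ¬ (keepers A v (restrict f (Y A v f b a)) (fun ξ => B ξ) F).Countable := by
    intro c d z
    by_cases h : ∃ a Φ b Ψ v f, c = ZFSet.pair a Φ ∧ d = ZFSet.pair b Ψ ∧ z = ZFSet.pair v f ∧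
      v ⊆ κ.toZFSet ∧ IsFinite v ∧ IsPromise (restrict f (Y A v f b a)) ∧ ∀ ξ ∈ v, B ξ ∈ I ξ
    · obtain ⟨a, Φ, b, Ψ, v, f, rfl, rfl, rfl, h1, h2, h3, h4⟩ := h
      obtain ⟨F, hF, hF'⟩ := exists_finite_keepers hI hA h1 h2 h3 h4
      refine ⟨F, hF, ?_⟩
      intro a' Φ' b' Ψ' v' f' e1 e2 e3 _ _ _ _
      obtain ⟨rfl, rfl⟩ := ZFSet.pair_inj.1 e1
      obtain ⟨rfl, rfl⟩ := ZFSet.pair_inj.1 e2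
      obtain ⟨rfl, rfl⟩ := ZFSet.pair_inj.1 e3
      exact hF'
    · exact ⟨∅, Set.finite_empty, fun a Φ b Ψ v f e1 e2 e3 h1 h2 h3 h4 =>
        absurd ⟨a, Φ, b, Ψ, v, f, e1, e2, e3, h1, h2, h3, h4⟩ h⟩
  choose G hGf hG using hG
  have hxN : ∀ k, x k ∈ N := fun k => hx ▸ ⟨k, rfl⟩
  -- A default dense set in `N`, used at the stages where `x m` is not dense.
  obtain ⟨D₀, hD₀, hD₀', -⟩ := T.decide p₀ hp₀ hp₀'
  obtain ⟨p, F, h0, h1, h2, h3, h4⟩ := exists_fusion_sequence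
    (Good := fun p => p ∈ N ∧ p ∈ conditions κ I)
    (Step := fun m F p q => (idealForcing κ I A).Ext q p ∧
      ((idealForcing κ I A).IsDense (x m) → q ∈ x m) ∧ ∀ k < m, x k ∈ κ.toZFSet →
        pt q (x k) \ pt p (x k) ⊆ (B (x k) : Set ZFSet.{u}) \ F)
    (G := fun c d k => G c d (x k) ∪ G (σ c) (σ d) (σ (x k)))
    (fun c d k => (hGf _ _ _).union (hGf _ _ _))
    (by
      rintro m F c ⟨hc, hc'⟩ hF
      obtain ⟨D, hD, hD', hDx⟩ : ∃ D ∈ N, (idealForcing κ I A).IsDense D ∧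
          ((idealForcing κ I A).IsDense (x m) → D = x m) := by
        by_cases h : (idealForcing κ I A).IsDense (x m)
        · exact ⟨_, hxN m, h, fun _ => rfl⟩
        · exact ⟨D₀, hD₀, hD₀', fun h' => absurd h' h⟩
      obtain ⟨d, hd, hdD, hdc, h⟩ := T.next c hc hc' D hD hD'
        (x '' {k | k < m ∧ x k ∈ κ.toZFSet})
        (((Set.finite_lt_nat m).subset fun k hk => hk.1).image x)
        (by rintro _ ⟨k, hk, rfl⟩; exact ⟨hxN k, hk.2⟩)
        (fun ξ => (B ξ : Set ZFSet.{u}) \ F)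
        (by
          rintro c hc hc' _ ⟨k, hk, rfl⟩
          refine ((hB _ (hxN k) hk.2 c hc hc').union hF).subset ?_
          rintro ζ ⟨hζ, hζ'⟩
          by_cases h : ζ ∈ F
          · exact .inr h
          · exact .inl ⟨hζ, fun h' => hζ' ⟨h', h⟩⟩)
      exact ⟨d, ⟨hd, hD'.1 hdD⟩, hdc, fun h' => hDx h' ▸ hdD,
        fun k hk hk' => h _ ⟨k, ⟨hk, hk'⟩, rfl⟩⟩)
    ⟨hp₀, hp₀'⟩
  refine ⟨p, F, h0, h1, fun m => (h2 m).1, fun m => (h2 m).2.1, fun m => (h2 m).2.2, h3, ?_⟩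
  intro τ hτ m n hn k hk a Φ b Ψ v f e1 e2 e3 hv hvf hf hvB hcount
  refine hG _ _ _ a Φ b Ψ v f e1 e2 e3 hv hvf hf hvB (hcount.mono (keepers_mono ?_))
  refine Set.Subset.trans ?_ (h4 m n hn k hk)
  rcases hτ with rfl | rfl
  · exact Set.subset_union_left
  · exact Set.subset_union_right

/-- The first coordinate of the lower bound is the union of those of all `p n` and `σ (p n)`. An
index common to both sides is its own preimage under `σ`, so the two sides agree there. Growth
inside the sets `B ξ` keeps the parts in the ideals, and avoidance of the finite sets `F m` keeps
the promises. -/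
theorem exists_generic (T : Twin κ I A N N' σ) (hI : ∀ ξ ∈ κ.toZFSet, IsPIdeal (I ξ))
    (hA : ∀ ξ ∈ κ.toZFSet, IsGeneratingSequence (I ξ) (A ξ)) {p₀ : ZFSet.{u}} (hp₀ : p₀ ∈ N)
    (hp₀' : p₀ ∈ conditions κ I) :
    ∃ q ∈ conditions κ I, (idealForcing κ I A).Ext q p₀ ∧
      ∀ D ∈ N, (idealForcing κ I A).IsDense D → ∃ d ∈ D, d ∈ N ∧
        (idealForcing κ I A).Ext q d ∧ (idealForcing κ I A).Ext q (σ d) := by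
  obtain ⟨B, hB⟩ := T.exists_pseudo_unions hI hA
  obtain ⟨x, hx⟩ := T.countable.exists_eq_range ⟨p₀, hp₀⟩
  obtain ⟨p, F, hp0, hpN, hpe, hpD, hpB, hF, hkeep⟩ := T.exists_sequence hI hA
    (fun η hη hη' => (hB η hη hη').2.2.2) hx hp₀ hp₀'
  have hxN : ∀ k, x k ∈ N := fun k => hx ▸ ⟨k, rfl⟩
  have hidx : ∀ η ∈ N, ∃ k, x k = η := fun η hη => by rw [hx] at hη; exact hη
  have hle : ∀ m n, n ≤ m → (idealForcing κ I A).Ext (p m) (p n) := fun m n h => by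
    induction m, h using Nat.le_induction with
    | base => exact (idealForcing κ I A).refl _ (hpN n).2
    | succ m _ ih => exact (idealForcing κ I A).trans _ _ _ (hpe m) ih
  have hgrow : ∀ m k, k < m → x k ∈ κ.toZFSet → ∀ j,
      pt (p j) (x k) \ pt (p m) (x k) ⊆ (B (x k) : Set ZFSet.{u}) \ F m := fun m k hk hκ j => by
    rcases le_total j m with hj | hj
    · rintro ζ ⟨hζ, hζ'⟩
      exact absurd (val_mono (hle m j hj) hζ) hζ'
    · induction j, hj using Nat.le_induction with
      | base => rintro ζ ⟨hζ, hζ'⟩; exact absurd hζ hζ'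
      | succ j hj ih =>
        rintro ζ ⟨hζ, hζ'⟩
        by_cases h : ζ ∈ pt (p j) (x k)
        · exact ih ⟨h, hζ'⟩
        · have := hpB j k (hk.trans_le hj) hκ ⟨hζ, h⟩
          exact ⟨this.1, fun h' => this.2 (hF hj h')⟩
  let τ : Bool → ZFSet.{u} → ZFSet.{u} := fun b => bif b then σ else id
  have hτ : ∀ b, τ b = id ∨ τ b = σ := by rintro (_ | _); exacts [.inl rfl, .inr rfl]
  have hτC : ∀ b n, τ b (p n) ∈ conditions κ I := by
    rintro (_ | _) n
    exacts [(hpN n).2, T.cond _ (hpN n).1 (hpN n).2]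
  have hτval : ∀ b n, ∀ η ∈ N, ∀ ζ ε, Val (τ b (p n)) (τ b η) ζ ε ↔ Val (p n) η ζ ε := by
    rintro (_ | _) n η hη ζ ε
    exacts [Iff.rfl, T.val _ (hpN n).1 (hpN n).2 η hη ζ ε]
  have hτsupp : ∀ b n ξ ζ ε, Val (τ b (p n)) ξ ζ ε → ∃ η ∈ N, η ∈ κ.toZFSet ∧ τ b η = ξ := by
    rintro (_ | _) n ξ ζ ε h
    · refine ⟨ξ, T.supp _ (hpN n).1 (hpN n).2 ξ ζ ε h, ?_, rfl⟩
      obtain ⟨a, Φ, e, ha⟩ := mem_conditions.1 (hpN n).2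
      have h : Val (p n) ξ ζ ε := h
      rw [e, val_pair] at h
      exact (ha.mem_of_pair_mem h).1
    · exact T.supp' _ (hpN n).1 (hpN n).2 ξ ζ ε h
  have hτprm : ∀ b n v f, Prm (τ b (p n)) v f → (∃ z ∈ N, τ b z = ZFSet.pair v f) ∧
      ∀ ξ ∈ v, ∃ η ∈ N, η ∈ κ.toZFSet ∧ τ b η = ξ := by
    rintro (_ | _) n v f h
    · obtain ⟨h1, h2⟩ := T.prm _ (hpN n).1 (hpN n).2 v f h
      exact ⟨⟨_, h1, rfl⟩, fun ξ hξ => ⟨ξ, h2 ξ hξ, (Prm.isPromise (hpN n).2 h).1 hξ, rfl⟩⟩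
    · exact T.prm' _ (hpN n).1 (hpN n).2 v f h
  have hτext : ∀ b m n, n ≤ m → (idealForcing κ I A).Ext (τ b (p m)) (τ b (p n)) := by
    rintro (_ | _) m n h
    exacts [hle m n h, T.ext _ (hpN n).1 _ (hpN m).1 (hle m n h)]
  have hτB : ∀ b, ∀ η ∈ N, η ∈ κ.toZFSet → B (τ b η) = B η ∧ B η ∈ I (τ b η) := by
    rintro (_ | _) η hη hη'
    exacts [⟨rfl, (hB η hη hη').2.1⟩, ⟨(hB η hη hη').1, (hB η hη hη').2.2.1⟩]
  -- The two copies of the index set overlap only in points fixed by `σ`, so an index of the union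
  -- has just one origin in `N`.
  have hτinj : ∀ b b', ∀ η ∈ N, ∀ η' ∈ N, τ b η = τ b' η' → η = η' := by
    have key : ∀ η ∈ N, ∀ η' ∈ N, σ η = η' → η = η' := by
      rintro η hη _ hη' rfl
      exact (T.inj hη' hη (T.fixed _ hη' (T.maps η hη))).symm
    rintro (_ | _) (_ | _) η hη η' hη' h
    exacts [h, (key η' hη' η hη h.symm).symm, key η hη η' hη' h, T.inj hη hη' h]
  choose a Φ hpair hcond using fun i : ℕ × Bool => mem_conditions.1 (hτC i.2 i.1)
  have hVal : ∀ b n ξ ζ ε, ZFSet.pair (ZFSet.pair ξ ζ) ε ∈ a (n, b) ↔ Val (τ b (p n)) ξ ζ ε :=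
    fun b n ξ ζ ε => by rw [hpair (n, b), val_pair]
  let c : ZFSet.{u} := ZFSet.iUnion a
  have hc : ∀ z, z ∈ c ↔ ∃ i, z ∈ a i := fun z => ZFSet.mem_iUnion
  have hcval : ∀ b, ∀ η ∈ N, ∀ ζ ε, ZFSet.pair (ZFSet.pair (τ b η) ζ) ε ∈ c ↔
      ∃ n, Val (p n) η ζ ε := fun b η hη ζ ε => by
    rw [hc]
    constructor
    · rintro ⟨⟨n, b'⟩, h⟩
      rw [hVal] at h
      obtain ⟨η', hη', -, e⟩ := hτsupp _ _ _ _ _ h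
      obtain rfl := hτinj _ _ _ hη' _ hη e
      rw [← e, hτval _ _ _ hη'] at h
      exact ⟨n, h⟩
    · rintro ⟨n, h⟩
      exact ⟨(n, b), (hVal _ _ _ _ _).2 ((hτval _ _ _ hη _ _).2 h)⟩
  have hcsupp : ∀ ξ ζ ε, ZFSet.pair (ZFSet.pair ξ ζ) ε ∈ c →
      ∃ b, ∃ η ∈ N, η ∈ κ.toZFSet ∧ τ b η = ξ := fun ξ ζ ε h => by
    obtain ⟨⟨n, b⟩, h⟩ := (hc _).1 h
    rw [hVal] at h
    exact ⟨b, hτsupp _ _ _ _ _ h⟩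
  have hcpart : ∀ b, ∀ η ∈ N, ∀ ζ, ζ ∈ part c (τ b η) → ∃ n, ζ ∈ pt (p n) η :=
    fun b η hη ζ h => (hcval b η hη ζ _).1 (mem_part.1 h).2
  have hpart : ∀ b n, ∀ η ∈ N, ∀ ζ, ζ ∈ part (a (n, b)) (τ b η) ↔ ζ ∈ pt (p n) η :=
    fun b n η hη ζ => by
      have := (hcond (n, b)).pt_eq (τ b η)
      rw [← hpair (n, b)] at this
      rw [← SetLike.mem_coe, ← this]
      exact hτval b n η hη ζ _
  have hcc : IsCondition κ I c ∅ := by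
    have he := isCondition_empty hI hA
    refine ⟨⟨fun z hz => ?_, fun y ε ε' h h' => ?_⟩, ?_, ?_, ?_, ?_, he.countable, he.promises⟩
    · obtain ⟨i, hi⟩ := (hc z).1 hz
      exact (hcond i).isFunction.1 z hi
    · obtain ⟨i, hi⟩ := (hc _).1 h
      obtain ⟨ξ, -, ζ, -, rfl⟩ := ZFSet.mem_prod.1 ((hcond i).dom_subset ⟨ε, hi⟩)
      obtain ⟨b, η, hη, -, rfl⟩ := hcsupp _ _ _ h
      obtain ⟨n, hn⟩ := (hcval b η hη ζ ε).1 h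
      obtain ⟨m, hm⟩ := (hcval b η hη ζ ε').1 h'
      have hn := (hτval b (max n m) η hη _ _).2 (val_mono (hle _ _ (le_max_left n m)) hn)
      have hm := (hτval b (max n m) η hη _ _).2 (val_mono (hle _ _ (le_max_right n m)) hm)
      rw [← hVal] at hn hm
      exact (hcond _).isFunction.2 _ _ _ hn hm
    · rintro y ⟨ε, h⟩
      obtain ⟨i, hi⟩ := (hc _).1 h
      exact (hcond i).dom_subset ⟨ε, hi⟩
    · refine (Set.countable_iUnion fun i => (hcond i).dom_countable).mono ?_
      rintro y ⟨ε, h⟩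
      obtain ⟨i, hi⟩ := (hc _).1 h
      exact Set.mem_iUnion.2 ⟨i, ε, hi⟩
    · rintro ε ⟨y, h⟩
      obtain ⟨i, hi⟩ := (hc _).1 h
      exact (hcond i).ran_subset ⟨y, hi⟩
    · intro ξ hξ
      by_cases h : ∃ b, ∃ η ∈ N, η ∈ κ.toZFSet ∧ τ b η = ξ
      · obtain ⟨b, η, hη, hηκ, rfl⟩ := h
        obtain ⟨k, rfl⟩ := hidx η hη
        -- Growth at the index `x k` is controlled from stage `k + 1` on, so the whole union is
        -- covered by the part at that stage and `B (x k)`.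
        refine (hI _ hξ).down _ ((hI _ hξ).union _ ((hcond (k + 1, b)).part_mem _ hξ) _
          (hτB b _ hη hηκ).2) _ fun ζ hζ => ?_
        obtain ⟨n, hn⟩ := hcpart b _ hη ζ hζ
        rw [ZFSet.mem_union, hpart b _ _ hη]
        by_cases h : ζ ∈ pt (p (k + 1)) (x k)
        · exact .inl h
        · exact .inr (hgrow (k + 1) k (Nat.lt_succ_self k) hηκ n ⟨hn, h⟩).1
      · have : part c ξ = ∅ := by
          rw [ZFSet.eq_empty]
          exact fun ζ hζ => h (hcsupp ξ ζ _ (mem_part.1 hζ).2)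
        rw [this]
        exact empty_mem_ideal hI hA hξ
  have hY : ∀ (i : ℕ × Bool) v f, ZFSet.pair v f ∈ Φ i → ¬ IsCountable (Y A v f c (a i)) := by
    rintro ⟨n, b⟩ v f hvf
    have hprm : Prm (τ b (p n)) v f := by rw [hpair (n, b)]; exact prm_pair.2 hvf
    obtain ⟨hv, hvfin, hf⟩ := Prm.isPromise (hτC b n) hprm
    obtain ⟨⟨z, hz, hzvf⟩, hvN⟩ := hτprm b n v f hprm
    obtain ⟨k, rfl⟩ := hidx z hz
    choose! η hη hηκ hητ using hvN
    choose! l hl using hidx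
    obtain ⟨m₀, hm₀⟩ := (hvfin.image (l ∘ η)).bddAbove
    -- A stage late enough for this promise to have contributed to `F m` and for growth at every
    -- index in `v` to be controlled.
    obtain ⟨m, hmn, hmk, hml⟩ : ∃ m, n ≤ m ∧ k ≤ m ∧ ∀ ξ ∈ v, l (η ξ) < m :=
      ⟨max (max n k) (m₀ + 1), by simp, by simp, fun ξ hξ =>
        (Nat.lt_succ_of_le (hm₀ ⟨ξ, hξ, rfl⟩)).trans_le (le_max_right _ _)⟩
    have hext := hτext b m n hmn
    rw [hpair (m, b), hpair (n, b)] at hext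
    have hpr := (hcond (m, b)).isPromise ((ext_pair.1 hext).2.2.keeps v f hvf).2
    refine fun hcount => hkeep (τ b) (hτ b) m n hmn k hmk _ _ _ _ v f (hpair (n, b))
      (hpair (m, b)) hzvf hv hvfin hpr.2.2 (fun ξ hξ => ?_) (hcount.mono ?_)
    · have := hτB b (η ξ) (hη ξ hξ) (hηκ ξ hξ)
      rw [hητ ξ hξ] at this
      rw [this.1]
      exact this.2
    · rintro α ⟨w, hw, hα⟩
      obtain ⟨hw, hαY⟩ := pair_mem_restrict.1 hw
      obtain ⟨hα1, w', hw', hαY⟩ := ZFSet.mem_sep.1 hαY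
      obtain rfl := hf.isFunction.2 _ _ _ hw hw'
      refine ZFSet.mem_sep.2 ⟨hα1, w, hw, fun ξ hξ ζ hζ => ?_⟩
      obtain ⟨hζ, hζ'⟩ := ZFSet.mem_sdiff.1 hζ
      -- Points added up to stage `m` are handled by the restriction of `f`. Points added later lie
      -- in `B ξ` outside `F m`, where `α` is a keeper.
      by_cases hm : ζ ∈ part (a (m, b)) ξ
      · exact hαY ξ hξ (ZFSet.mem_sdiff.2 ⟨hm, hζ'⟩)
      · rw [← hητ ξ hξ] at hζ hm
        rw [hpart b m _ (hη ξ hξ)] at hm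
        obtain ⟨j, hj⟩ := hcpart b _ (hη ξ hξ) ζ hζ
        have hl' := hl _ (hη ξ hξ)
        have h1 := hgrow m _ (hml ξ hξ) (by rw [hl']; exact hηκ ξ hξ) j
        rw [hl'] at h1
        have h2 := h1 ⟨hj, hm⟩
        have h3 := (hτB b (η ξ) (hη ξ hξ) (hηκ ξ hξ)).1
        rw [hητ ξ hξ] at h3
        refine ZFSet.mem_sdiff.2 (hα ξ hξ ζ ?_ h2.2)
        change ζ ∈ B ξ
        rw [h3]
        exact h2.1
  obtain ⟨Ψ, hΨ, hext⟩ := exists_common_extension hcond hcc (fun i z hz => (hc z).2 ⟨i, hz⟩) hY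
  have hq : ∀ b n, (idealForcing κ I A).Ext (ZFSet.pair c Ψ) (τ b (p n)) := fun b n => by
    rw [hpair (n, b)]
    exact ext_pair.2 ⟨hΨ, hcond _, hext _⟩
  refine ⟨_, pair_mem_conditions.2 hΨ, hp0 ▸ hq false 0, fun D hD hD' => ?_⟩
  obtain ⟨k, rfl⟩ := hidx D hD
  exact ⟨_, hpD k hD', (hpN _).1, hq false _, hq true _⟩

end Twin

/-! ### Conditions in elementary submodels -/

theorem IsCondition.countable_fun {a Φ : ZFSet.{u}} (h : IsCondition κ I a Φ) :
    (a : Set ZFSet.{u}).Countable := by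
  refine (h.dom_countable.biUnion (t := fun x _ => {z | ∃ y, z = ZFSet.pair x y ∧ z ∈ a})
    fun x _ => Set.Subsingleton.countable ?_).mono fun z hz => ?_
  · rintro _ ⟨y, rfl, hy⟩ _ ⟨y', rfl, hy'⟩
    rw [h.isFunction.2 x y y' hy hy']
  · obtain ⟨x, y, rfl⟩ := h.isFunction.1 z hz
    exact Set.mem_biUnion ⟨y, hz⟩ ⟨y, rfl, hz⟩

theorem Val.mem_of_condition {c ξ ζ ε : ZFSet.{u}} (h : Val c ξ ζ ε) (hc : c ∈ conditions κ I) :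
    ξ ∈ κ.toZFSet ∧ ζ ∈ om1 ∧ (ε = ∅ ∨ ε = {∅}) := by
  obtain ⟨a, Φ, rfl, ha⟩ := mem_conditions.1 hc
  rw [val_pair] at h
  obtain ⟨h1, h2⟩ := ha.mem_of_pair_mem h
  exact ⟨h1, h2, ZFSet.mem_pair.1 (ha.ran_subset ⟨_, h⟩)⟩

namespace Submodel

variable {lam : Cardinal.{u}} {N : Submodel lam}

theorem els_of_val (hlam : lam.IsRegular) (hlam' : ℵ₀ < lam) {c ξ ζ ε : ZFSet.{u}}
    (hc : c ∈ N.els) (hc' : c ∈ conditions κ I) (h : Val c ξ ζ ε) :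
    ξ ∈ N.els ∧ ζ ∈ N.els ∧ ε ∈ N.els := by
  obtain ⟨a, Φ, rfl, ha⟩ := mem_conditions.1 hc'
  rw [val_pair] at h
  have h1 := els_of_pair hlam.aleph0_le (els_of_mem_countable hlam hlam'
    (els_of_pair hlam.aleph0_le hc).1 ha.countable_fun h)
  have h2 := els_of_pair hlam.aleph0_le h1.1
  exact ⟨h2.1, h2.2, h1.2⟩

theorem els_of_prm (hlam : lam.IsRegular) (hlam' : ℵ₀ < lam) {c v f : ZFSet.{u}}
    (hc : c ∈ N.els) (hc' : c ∈ conditions κ I) (h : Prm c v f) :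
    ZFSet.pair v f ∈ N.els ∧ ∀ ξ ∈ v, ξ ∈ N.els := by
  obtain ⟨a, Φ, rfl, ha⟩ := mem_conditions.1 hc'
  have hvf := ((Prm.isPromise hc' h).2.1).countable
  rw [prm_pair] at h
  have h1 := els_of_mem_countable hlam hlam' (els_of_pair hlam.aleph0_le hc).2 ha.countable h
  exact ⟨h1, fun ξ hξ => els_of_mem_countable hlam hlam' (els_of_pair hlam.aleph0_le h1).1 hvf hξ⟩

theorem om1_mem_els (hlam : ℵ₀ ≤ lam) (hI : ∀ ξ ∈ κ.toZFSet, IsPIdeal (I ξ))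
    (hA : ∀ ξ ∈ κ.toZFSet, IsGeneratingSequence (I ξ) (A ξ)) (hom : om1 ∈ H lam)
    (hC : conditions κ I ∈ N.els) : om1 ∈ N.els := by
  refine els_of_def (T := fun x C _ => ∀ α : H lam, α.1 ∈ x.1 ↔ InDom C.1 α.1)
    (Def.all ((Def.mem _ _).iff (Def.inDom hlam _ _))) hC hC hom
    (fun α => (inDom_conditions hI hA).symm) fun y hy => ?_
  rw [← Def.forall_H_iff_eq (y := ⟨om1, hom⟩)]
  exact fun α => (hy α).trans (inDom_conditions hI hA)

/-- The countable ordinals in a countable elementary submodel form a countable ordinal. -/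
theorem exists_inter_om1 (hlam : lam.IsRegular) (hlam' : ℵ₀ < lam) (hN : N.els.Countable) :
    ∃ δ ∈ om1, ∀ α ∈ om1, α ∈ N.els ↔ α ∈ δ := by
  -- The required ordinal is the least countable ordinal outside `N`; nothing above it is in `N`,
  -- since countable elements of `N` are included in `N`.
  let s : Set Ordinal.{u} := {a | a < ω_ 1 ∧ a.toZFSet ∉ N.els}
  have hs : s.Nonempty := by
    by_contra h
    refine not_countable_om1 (hN.mono fun α hα => ?_)
    obtain ⟨a, ha, rfl⟩ := mem_om1.1 hα
    by_contra h'
    exact h ⟨a, ha, h'⟩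
  obtain ⟨h1, h2⟩ := csInf_mem hs
  refine ⟨(sInf s).toZFSet, mem_om1.2 ⟨_, h1, rfl⟩, fun α hα => ?_⟩
  obtain ⟨a, ha, rfl⟩ := mem_om1.1 hα
  rw [Ordinal.toZFSet_mem_toZFSet_iff]
  constructor
  · intro h
    by_contra! h'
    rcases h'.eq_or_lt with h' | h'
    · exact h2 (h' ▸ h)
    · exact h2 (els_of_mem_countable hlam hlam' h (countable_of_mem_om1 hα)
        (Ordinal.toZFSet_mem_toZFSet_iff.2 h'))
  · intro h
    by_contra haN
    exact notMem_of_lt_csInf' h ⟨ha, haN⟩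

/-- A dense set of conditions that decide whether `r` is in the generic set. -/
theorem exists_deciding (hlam : ℵ₀ ≤ lam) {P : ForcingNotion.{u}} (hC : P.carrier ∈ N.els)
    (hrel : P.rel ∈ N.els) {r : ZFSet.{u}} (hr : r ∈ N.els) :
    ∃ D ∈ N.els, P.IsDense D ∧ ∀ d ∈ D, P.Ext d r ∨ ∀ e, P.Ext e d → ¬ P.Ext e r := by
  let D : ZFSet.{u} := P.carrier.sep fun d => P.Ext d r ∨ ∀ e, P.Ext e d → ¬ P.Ext e r
  have hDmem : ∀ d, d ∈ D ↔ d ∈ P.carrier ∧ (P.Ext d r ∨ ∀ e, P.Ext e d → ¬ P.Ext e r) :=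
    fun d => ZFSet.mem_sep
  have hDH : D ∈ H lam := H_of_subset (H_of_els hC) ZFSet.sep_subset
  -- By reflexivity, membership in the carrier is the relation of `d` to itself, so the ordering and
  -- `r` are the only parameters.
  have key : ∀ d : H lam, (ZFSet.pair d.1 d.1 ∈ P.rel ∧ (ZFSet.pair d.1 r ∈ P.rel ∨
      ∀ e : H lam, ZFSet.pair e.1 d.1 ∈ P.rel → ¬ ZFSet.pair e.1 r ∈ P.rel)) ↔ d.1 ∈ D :=
    fun d => by
      rw [hDmem]
      refine and_congr ⟨fun h => (mem_carrier_of_ext h).1, P.refl _⟩ (or_congr Iff.rfl ?_)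
      exact ⟨fun h e he => h ⟨e, H_of_pair_left (H_of_mem (H_of_els hrel) he)⟩ he,
        fun h e => h e.1⟩
  refine ⟨D, ?_, ⟨ZFSet.sep_subset, fun p hp => ?_⟩, fun d hd => ((hDmem d).1 hd).2⟩
  · refine els_of_def (T := fun D R r => ∀ d : H lam, d.1 ∈ D.1 ↔
      (ZFSet.pair d.1 d.1 ∈ R.1 ∧ (ZFSet.pair d.1 r.1 ∈ R.1 ∨
        ∀ e : H lam, ZFSet.pair e.1 d.1 ∈ R.1 → ¬ ZFSet.pair e.1 r.1 ∈ R.1)))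
      (Def.all ((Def.mem _ _).iff ((Def.pair_mem hlam _ _ _).and ((Def.pair_mem hlam _ _ _).or
        (Def.all ((Def.pair_mem hlam _ _ _).imp (Def.pair_mem hlam _ _ _).not))))))
      hrel hr hDH (fun d => (key d).symm) fun y hy => ?_
    rw [← Def.forall_H_iff_eq (y := ⟨D, hDH⟩)]
    exact fun d => (hy d).trans (key d)
  · by_cases h : ∃ e, P.Ext e p ∧ P.Ext e r
    · obtain ⟨e, h1, h2⟩ := h
      exact ⟨e, (hDmem e).2 ⟨(mem_carrier_of_ext h1).1, .inl h2⟩, h1⟩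
    · exact ⟨p, (hDmem p).2 ⟨hp, .inr fun e h1 h2 => h ⟨e, h1, h2⟩⟩, P.refl p hp⟩

end Submodel

/-- The property in `H(lam)` of the two `ω₁`-sequences of `exists_reflecting`. -/
def Reflects {lam : Cardinal.{u}} (C rel D p w S R γ : H lam) : Prop :=
  InDom C.1 γ.1 ∧
    (∀ β c : H lam, ZFSet.pair β.1 c.1 ∈ S.1 →
      c.1 ∈ C.1 ∧ ∀ c' : H lam, ZFSet.pair β.1 c'.1 ∈ S.1 → c'.1 = c.1) ∧
    (∀ β d : H lam, ZFSet.pair β.1 d.1 ∈ R.1 →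
      d.1 ∈ D.1 ∧ ZFSet.pair d.1 p.1 ∈ rel.1 ∧
        ∀ d' : H lam, ZFSet.pair β.1 d'.1 ∈ R.1 → d'.1 = d.1) ∧
    ∀ α : H lam, InDom C.1 α.1 → γ.1 ∈ α.1 → ∀ B : H lam,
      (∀ ξ : H lam, ξ.1 ∈ w.1 → ∀ β : H lam, β.1 ∈ α.1 → ∀ c : H lam, ZFSet.pair β.1 c.1 ∈ S.1 →
        ∃ x : H lam, InRan C.1 x.1 ∧
          ∀ ζ : H lam, ζ.1 ∈ pt c.1 ξ.1 → ζ.1 ∈ x.1 ∨ ZFSet.pair ξ.1 ζ.1 ∈ B.1) →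
      ∃ β : H lam, β.1 ∈ α.1 ∧ ∃ d : H lam, ZFSet.pair β.1 d.1 ∈ R.1 ∧
        ∀ ξ : H lam, ξ.1 ∈ w.1 → ∀ ζ : H lam, ζ.1 ∈ pt d.1 ξ.1 →
          ζ.1 ∈ pt p.1 ξ.1 ∨ ZFSet.pair ξ.1 ζ.1 ∈ B.1

theorem Def.reflects {lam : Cardinal.{u}} (hlam : ℵ₀ ≤ lam) (C rel D p w S R γ : ℕ) :
    Def fun v : ℕ → H lam =>
      Reflects (v C) (v rel) (v D) (v p) (v w) (v S) (v R) (v γ) :=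
  (Def.inDom hlam _ _).and <|
    (Def.all <| Def.all <| (Def.pair_mem hlam _ _ _).imp <| (Def.mem _ _).and <|
      Def.all <| (Def.pair_mem hlam _ _ _).imp <| Def.eq _ _).and <|
    (Def.all <| Def.all <| (Def.pair_mem hlam _ _ _).imp <| (Def.mem _ _).and <|
      (Def.pair_mem hlam _ _ _).and <|
      Def.all <| (Def.pair_mem hlam _ _ _).imp <| Def.eq _ _).and <|
    Def.all <| (Def.inDom hlam _ _).imp <| (Def.mem _ _).imp <| Def.all <|
      (Def.all <| (Def.mem _ _).imp <| Def.all <| (Def.mem _ _).imp <| Def.all <|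
        (Def.pair_mem hlam _ _ _).imp <| Def.ex <| (Def.inRan hlam _ _).and <|
        Def.all <| (Def.mem_pt hlam _ _ _).imp <| (Def.mem _ _).or (Def.pair_mem hlam _ _ _)).imp <|
      Def.ex <| (Def.mem _ _).and <| Def.ex <| (Def.pair_mem hlam _ _ _).and <|
        Def.all <| (Def.mem _ _).imp <| Def.all <| (Def.mem_pt hlam _ _ _).imp <|
          (Def.mem_pt hlam _ _ _).or (Def.pair_mem hlam _ _ _)

variable {lam : Cardinal.{u}}

theorem exists_reflects (hCH : Cardinal.continuum.{u} = ℵ_ 1)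
    (hI : ∀ ξ ∈ κ.toZFSet, IsPIdeal (I ξ))
    (hA : ∀ ξ ∈ κ.toZFSet, IsGeneratingSequence (I ξ) (A ξ))
    (hH : om1.prod (conditions κ I) ∈ H lam) (hom : om1 ∈ H lam) {C rel D p w : H lam}
    (hC : C.1 = conditions κ I) (hrel : rel.1 = ordering κ I A)
    (hp : p.1 ∈ conditions κ I) (hD : (idealForcing κ I A).IsDense D.1)
    (hw : w.1 ⊆ κ.toZFSet) (hwf : IsFinite w.1) :
    ∃ S R γ : H lam, Reflects C rel D p w S R γ := by
  obtain ⟨S, R, γ, hγ, hS, h⟩ := exists_reflecting hCH hI hA hp hD hw hwf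
  let S' : ZFSet.{u} := (om1.prod (conditions κ I)).sep fun z => ∃ β, z = ZFSet.pair β (S β)
  -- Only the useful values are retained, so that every value of the partial function `R'` is an
  -- extension of `p` in `D`.
  let R' : ZFSet.{u} := (om1.prod (conditions κ I)).sep fun z => ∃ β, z = ZFSet.pair β (R β) ∧
    R β ∈ D.1 ∧ (idealForcing κ I A).Ext (R β) p.1
  have hS' : ∀ β c, ZFSet.pair β c ∈ S' ↔ β ∈ om1 ∧ c = S β := fun β c => by
    rw [ZFSet.mem_sep, ZFSet.pair_mem_prod]
    constructor
    · rintro ⟨h1, β', e⟩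
      obtain ⟨rfl, rfl⟩ := ZFSet.pair_inj.1 e
      exact ⟨h1.1, rfl⟩
    · rintro ⟨h1, rfl⟩
      exact ⟨⟨h1, hS β h1⟩, β, rfl⟩
  have hR' : ∀ β d, ZFSet.pair β d ∈ R' ↔ β ∈ om1 ∧ d = R β ∧ R β ∈ D.1 ∧
      (idealForcing κ I A).Ext (R β) p.1 := fun β d => by
    rw [ZFSet.mem_sep, ZFSet.pair_mem_prod]
    constructor
    · rintro ⟨h1, β', e, h2⟩
      obtain ⟨rfl, rfl⟩ := ZFSet.pair_inj.1 e
      exact ⟨h1.1, rfl, h2⟩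
    · rintro ⟨h1, rfl, h2⟩
      exact ⟨⟨h1, hD.1 h2.1⟩, β, rfl, h2⟩
  refine ⟨⟨S', H_of_subset hH ZFSet.sep_subset⟩, ⟨R', H_of_subset hH ZFSet.sep_subset⟩,
    ⟨γ, H_of_mem hom hγ⟩, ?_, ?_, ?_, ?_⟩
  · rw [hC]
    exact (inDom_conditions hI hA).2 hγ
  · intro β c hc
    obtain ⟨h1, h2⟩ := (hS' _ _).1 hc
    refine ⟨?_, fun c' hc' => ?_⟩
    · rw [hC, h2]
      exact hS _ h1
    · rw [h2, ((hS' _ _).1 hc').2]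
  · intro β d hd
    obtain ⟨h1, h2, h3, h4⟩ := (hR' _ _).1 hd
    refine ⟨h2 ▸ h3, ?_, fun d' hd' => ?_⟩
    · rw [hrel, h2]
      exact h4
    · rw [h2, ((hR' _ _).1 hd').2.1]
  · intro α hα hγα B hB
    rw [hC] at hα hB
    have hα := (inDom_conditions hI hA).1 hα
    obtain ⟨β, hβ, h1, h2, h3⟩ := h α.1 hα hγα (fun ξ => {ζ | ZFSet.pair ξ ζ ∈ B.1}) (by
      intro ξ hξ β hβ
      have hβ1 := mem_om1_trans hβ hα
      have hSβ := (hS' β _).2 ⟨hβ1, rfl⟩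
      have hSβH : S β ∈ H lam := H_of_pair_right (H_of_mem hH (ZFSet.sep_subset hSβ))
      obtain ⟨x, hx, hx'⟩ := hB ⟨ξ, H_of_mem w.2 hξ⟩ hξ ⟨β, H_of_mem α.2 hβ⟩ hβ ⟨S β, hSβH⟩ hSβ
      refine Set.Finite.subset ((inRan_conditions hI hA).1 hx).1 ?_
      rintro ζ ⟨hζ, hζ'⟩
      exact (hx' ⟨ζ, (Val.mem_H hζ hSβH).2.1⟩ hζ).resolve_right hζ')
    have hRβ := (hR' β _).2 ⟨mem_om1_trans hβ hα, rfl, h1, h2⟩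
    refine ⟨⟨β, H_of_mem α.2 hβ⟩, hβ, ⟨R β, H_of_mem D.2 h1⟩, hRβ, fun ξ hξ ζ hζ => ?_⟩
    by_contra! hcon
    exact hcon.2 (h3 ξ.1 hξ ⟨hζ, hcon.1⟩)

namespace Submodel

variable {N : Submodel lam}

/-- Extensions in a dense set with small new parts can be found in the submodel. -/
theorem exists_small_extension (hCH : Cardinal.continuum.{u} = ℵ_ 1)
    (hI : ∀ ξ ∈ κ.toZFSet, IsPIdeal (I ξ))
    (hA : ∀ ξ ∈ κ.toZFSet, IsGeneratingSequence (I ξ) (A ξ)) (hlam : lam.IsRegular)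
    (hlam' : ℵ₀ < lam) (hH : om1.prod (conditions κ I) ∈ H lam) (hom : om1 ∈ H lam)
    (hκ : κ.toZFSet.prod om1 ∈ H lam) (hN : N.els.Countable)
    (hC : conditions κ I ∈ N.els) (hrel : ordering κ I A ∈ N.els) {p D : ZFSet.{u}}
    (hp : p ∈ N.els) (hp' : p ∈ conditions κ I) (hD : D ∈ N.els)
    (hD' : (idealForcing κ I A).IsDense D) {w : Set ZFSet.{u}} (hw : w.Finite)
    (hw' : ∀ ξ ∈ w, ξ ∈ N.els ∧ ξ ∈ κ.toZFSet) {B : ZFSet.{u} → Set ZFSet.{u}}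
    (hB : ∀ c ∈ N.els, c ∈ conditions κ I → ∀ ξ ∈ w, (pt c ξ \ B ξ).Finite) :
    ∃ d ∈ N.els, d ∈ D ∧ (idealForcing κ I A).Ext d p ∧ ∀ ξ ∈ w, pt d ξ \ pt p ξ ⊆ B ξ := by
  have hl := hlam.aleph0_le
  obtain ⟨w, hwN, rfl⟩ := els_of_finite hl hp hw fun ξ hξ => (hw' ξ hξ).1
  have hC' := mem_of_els hC
  have hrel' := mem_of_els hrel
  have hp'' := mem_of_els hp
  have hD'' := mem_of_els hD
  have hwN' := mem_of_els hwN
  have h1 := exists_reflects hCH hI hA hH hom (C := ⟨_, H_of_els hC⟩) (rel := ⟨_, H_of_els hrel⟩)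
    (D := ⟨_, H_of_els hD⟩) (p := ⟨_, H_of_els hp⟩) (w := ⟨_, H_of_els hwN⟩) rfl rfl hp' hD'
    (fun ξ hξ => (hw' ξ hξ).2) hw
  obtain ⟨S, hS, h2⟩ := Def.exists_mem (N := N)
    (T := fun v S => ∃ R γ, Reflects (v 0) (v 1) (v 2) (v 3) (v 4) S R γ)
    (Def.ex (Def.ex (Def.reflects hl _ _ _ _ _ _ _ _)))
    (env_all (p := (· ∈ N)) hC' hrel' hD'' hp'' hwN' hwN' hwN') h1
  obtain ⟨R, hR, h3⟩ := Def.exists_mem (N := N)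
    (T := fun v R => ∃ γ, Reflects (v 0) (v 1) (v 2) (v 3) (v 4) (v 5) R γ)
    (Def.ex (Def.reflects hl _ _ _ _ _ _ _ _))
    (env_all (p := (· ∈ N)) hC' hrel' hD'' hp'' hwN' hS hS) h2
  obtain ⟨γ, hγ, h4, h5, h6, h7⟩ := Def.exists_mem (N := N)
    (T := fun v γ => Reflects (v 0) (v 1) (v 2) (v 3) (v 4) (v 5) (v 6) γ)
    (Def.reflects hl _ _ _ _ _ _ _ _)
    (env_all (p := (· ∈ N)) hC' hrel' hD'' hp'' hwN' hS hR) h3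
  obtain ⟨δ, hδ, hδN⟩ := exists_inter_om1 hlam hlam' hN
  -- The family `B` is coded by an element of `H lam` that need not be in `N`. This is harmless:
  -- `S`, `R`, `γ` are in `N`, but `Reflects` is evaluated in `H lam`, and so may be applied to `B'`
  -- and to `δ`, the set of countable ordinals of `N`.
  let B' : ZFSet.{u} := (κ.toZFSet.prod om1).sep fun z => ∃ ξ ζ, z = ZFSet.pair ξ ζ ∧ ζ ∈ B ξ
  have hB' : ∀ ξ ζ, ZFSet.pair ξ ζ ∈ B' ↔ (ξ ∈ κ.toZFSet ∧ ζ ∈ om1) ∧ ζ ∈ B ξ := fun ξ ζ => by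
    rw [ZFSet.mem_sep, ZFSet.pair_mem_prod]
    refine and_congr_right fun _ => ⟨?_, fun h => ⟨ξ, ζ, rfl, h⟩⟩
    rintro ⟨ξ', ζ', e, h⟩
    obtain ⟨rfl, rfl⟩ := ZFSet.pair_inj.1 e
    exact h
  have hγ1 := (inDom_conditions hI hA).1 h4
  obtain ⟨β, hβ, d, hd, h8⟩ := h7 ⟨δ, H_of_mem hom hδ⟩ ((inDom_conditions hI hA).2 hδ)
    ((hδN _ hγ1).1 (coe_mem_els.2 hγ)) ⟨B', H_of_subset hκ ZFSet.sep_subset⟩ (by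
      intro ξ hξ β hβ c hc
      have hξκ := (hw' ξ.1 hξ).2
      have hβN := (hδN _ (mem_om1_trans hβ hδ)).2 hβ
      obtain ⟨hcC, hcu⟩ := h5 β c hc
      have hcN := els_of_function hl (coe_mem_els.2 hS) hβN hc fun c' hc' =>
        hcu ⟨c', H_of_pair_right (H_of_mem S.2 hc')⟩ hc'
      have hfin := hB _ hcN hcC ξ.1 hξ
      obtain ⟨x, hx⟩ := exists_coe_eq_of_countable hfin.countable
      have hxmem : ∀ ζ, ζ ∈ x ↔ ζ ∈ pt c.1 ξ.1 \ B ξ.1 := fun ζ => by rw [← hx, SetLike.mem_coe]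
      have hxom : x ⊆ om1 := fun ζ hζ => (Val.mem_of_condition ((hxmem ζ).1 hζ).1 hcC).2.1
      refine ⟨⟨x, H_of_subset hom hxom⟩, (inRan_conditions hI hA).2 ⟨?_, hxom⟩, fun ζ hζ => ?_⟩
      · rw [IsFinite, hx]
        exact hfin
      · by_cases h : ζ.1 ∈ B ξ.1
        · exact .inr ((hB' _ _).2 ⟨⟨hξκ, (Val.mem_of_condition hζ hcC).2.1⟩, h⟩)
        · exact .inl ((hxmem _).2 ⟨hζ, h⟩))
  obtain ⟨hdD, hdp, hdu⟩ := h6 β d hd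
  have hβN := (hδN _ (mem_om1_trans hβ hδ)).2 hβ
  refine ⟨d.1, els_of_function hl (coe_mem_els.2 hR) hβN hd fun d' hd' =>
    hdu ⟨d', H_of_pair_right (H_of_mem R.2 hd')⟩ hd', hdD, hdp, fun ξ hξ => ?_⟩
  rintro ζ ⟨hζ, hζ'⟩
  exact ((hB' _ _).1 ((h8 ⟨ξ, H_of_mem (H_of_els hwN) hξ⟩ hξ
    ⟨ζ, (Val.mem_H hζ d.2).2.1⟩ hζ).resolve_left hζ')).2

/-! ### Isomorphisms of submodels -/

variable {N' : Submodel lam}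

open Classical in
/-- An isomorphism of submodels as a function on sets. -/
noncomputable def isoFun (h : N ≃[setLang] N') (x : ZFSet.{u}) : ZFSet.{u} :=
  if hx : x ∈ N.els then val (h ⟨⟨x, H_of_els hx⟩, mem_of_els hx⟩) else x

theorem isoFun_val (h : N ≃[setLang] N') (x : N) : isoFun h (val x) = val (h x) := by
  have hx : val x ∈ N.els := ⟨x.1, x.2, rfl⟩
  rw [isoFun, dif_pos hx]
  rfl

theorem exists_val_eq {x : ZFSet.{u}} (hx : x ∈ N.els) : ∃ y : N, val y = x :=
  ⟨⟨⟨x, H_of_els hx⟩, mem_of_els hx⟩, rfl⟩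

theorem val_mem_els (x : N) : val x ∈ N.els := ⟨x.1, x.2, rfl⟩

theorem isoFun_iff (h : N ≃[setLang] N') {T : ZFSet.{u} → ZFSet.{u} → ZFSet.{u} → ZFSet.{u} → Prop}
    (hT : Def fun v : ℕ → H lam => T (v 0).1 (v 1).1 (v 2).1 (v 3).1) {a b c d : ZFSet.{u}}
    (ha : a ∈ N.els) (hb : b ∈ N.els) (hc : c ∈ N.els) (hd : d ∈ N.els) :
    T (isoFun h a) (isoFun h b) (isoFun h c) (isoFun h d) ↔ T a b c d := by
  obtain ⟨a, rfl⟩ := exists_val_eq ha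
  obtain ⟨b, rfl⟩ := exists_val_eq hb
  obtain ⟨c, rfl⟩ := exists_val_eq hc
  obtain ⟨d, rfl⟩ := exists_val_eq hd
  simp only [isoFun_val]
  exact (hT.iso_iff h (env a b c d d d d)).symm

theorem isoFun_injOn (h : N ≃[setLang] N') : Set.InjOn (isoFun h) N.els := by
  intro x hx y hy e
  exact (isoFun_iff h (T := fun x y _ _ => x = y) (Def.eq _ _) hx hy hx hx).1 e

theorem isoFun_mem (h : N ≃[setLang] N') {x : ZFSet.{u}} (hx : x ∈ N.els) :
    isoFun h x ∈ N'.els := by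
  obtain ⟨x, rfl⟩ := exists_val_eq hx
  rw [isoFun_val]
  exact val_mem_els _

theorem exists_isoFun_eq (h : N ≃[setLang] N') {y : ZFSet.{u}} (hy : y ∈ N'.els) :
    ∃ x ∈ N.els, isoFun h x = y := by
  obtain ⟨y, rfl⟩ := exists_val_eq hy
  refine ⟨val (h.symm y), val_mem_els _, ?_⟩
  rw [isoFun_val, FirstOrder.Language.Equiv.apply_symm_apply]

/-- The set of conditions and the ordering lie in both submodels, so `h` fixes them and preserves
everything definable from them. Countable ordinals and the values 0 and 1 are fixed too, which is
why coordinates are preserved literally and not only up to `h`. -/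
theorem twin (hCH : Cardinal.continuum.{u} = ℵ_ 1)
    (hI : ∀ ξ ∈ κ.toZFSet, IsPIdeal (I ξ))
    (hA : ∀ ξ ∈ κ.toZFSet, IsGeneratingSequence (I ξ) (A ξ)) (hlam : lam.IsRegular)
    (hlam' : ℵ₀ < lam) (hH : om1.prod (conditions κ I) ∈ H lam) (hom : om1 ∈ H lam)
    (hκ : κ.toZFSet.prod om1 ∈ H lam) (hN : N.els.Countable)
    (hC : conditions κ I ∈ N.els) (hrel : ordering κ I A ∈ N.els)
    (hC' : conditions κ I ∈ N'.els) (hrel' : ordering κ I A ∈ N'.els) (h : N ≃[setLang] N')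
    (hfix : ∀ x : N, val x ∈ N'.els → val (h x) = val x)
    (hNN : ∀ α ∈ om1, α ∈ N.els ↔ α ∈ N'.els) :
    Twin κ I A N.els N'.els (isoFun h) := by
  have hl := hlam.aleph0_le
  have fixed : ∀ x ∈ N.els, x ∈ N'.els → isoFun h x = x := fun x hx hx' => by
    obtain ⟨x, rfl⟩ := exists_val_eq hx
    rw [isoFun_val, hfix x hx']
  have hCfix := fixed _ hC hC'
  have hrelfix := fixed _ hrel hrel'
  have hidx : ∀ ξ ∈ N.els, isoFun h ξ ∈ κ.toZFSet ↔ ξ ∈ κ.toZFSet := fun ξ hξ => by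
    have := isoFun_iff h (T := fun C ξ _ _ => InIdx C ξ) (Def.inIdx hl _ _) hC hξ hξ hξ
    rwa [hCfix, inIdx_conditions hI hA, inIdx_conditions hI hA] at this
  have hcond : ∀ c ∈ N.els, c ∈ conditions κ I → isoFun h c ∈ conditions κ I := fun c hc hc' => by
    have := isoFun_iff h (T := fun C c _ _ => c ∈ C) (Def.mem _ _) hC hc hc hc
    rw [hCfix] at this
    exact this.2 hc'
  have hext : ∀ p ∈ N.els, ∀ q ∈ N.els, (idealForcing κ I A).Ext (isoFun h q) (isoFun h p) ↔
      (idealForcing κ I A).Ext q p := fun p hp q hq => by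
    have := isoFun_iff h (T := fun R q p _ => ZFSet.pair q p ∈ R) (Def.pair_mem hl _ _ _)
      hrel hq hp hp
    rwa [hrelfix] at this
  have hpre : ∀ ξ ∈ N'.els, ξ ∈ κ.toZFSet → ∃ η ∈ N.els, η ∈ κ.toZFSet ∧ isoFun h η = ξ :=
    fun ξ hξ hξκ => by
      obtain ⟨η, hη, rfl⟩ := exists_isoFun_eq h hξ
      exact ⟨η, hη, (hidx η hη).1 hξκ, rfl⟩
  have hbit : ∀ (M : Submodel lam), conditions κ I ∈ M.els → ∀ ε, ε = ∅ ∨ ε = {∅} → ε ∈ M.els := by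
    rintro M hM ε (rfl | rfl)
    · exact els_empty hl hM
    · have h0 := els_empty hl hM
      have := els_insert hl h0 h0
      rwa [LawfulSingleton.insert_empty_eq] at this
  refine
    { countable := hN
      inj := isoFun_injOn h
      fixed := fixed
      maps := fun x hx => isoFun_mem h hx
      idx := fun ξ hξ => (hidx ξ hξ).2
      cond := hcond
      val := ?_
      supp := fun c hc hc' ξ ζ ε hv => (els_of_val hlam hlam' hc hc' hv).1
      supp' := fun c hc hc' ξ ζ ε hv => hpre ξ
        (els_of_val hlam hlam' (isoFun_mem h hc) (hcond c hc hc') hv).1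
        (Val.mem_of_condition hv (hcond c hc hc')).1
      prm := fun c hc hc' v f => els_of_prm hlam hlam' hc hc'
      prm' := ?_
      ext := fun p hp q hq => (hext p hp q hq).2
      compat := ?_
      decide := fun r hr _ => exists_deciding hl (P := idealForcing κ I A) hC hrel hr
      next := fun p hp hp' D hD hD' w hw hw' B hB => exists_small_extension hCH hI hA hlam hlam'
        hH hom hκ hN hC hrel hp hp' hD hD' hw hw' hB }
  · intro c hc hc' ξ hξ ζ ε
    have key : ∀ ζ ε, ζ ∈ om1 → ε = ∅ ∨ ε = {∅} → ζ ∈ N.els →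
        (Val (isoFun h c) (isoFun h ξ) ζ ε ↔ Val c ξ ζ ε) := fun ζ ε hζ hε hζN => by
      have := isoFun_iff h (T := Val) (Def.val hl _ _ _ _) hc hξ hζN (hbit N hC ε hε)
      rwa [fixed ζ hζN ((hNN ζ hζ).1 hζN),
        fixed ε (hbit N hC ε hε) (hbit N' hC' ε hε)] at this
    constructor
    · intro hv
      obtain ⟨-, h1, h2⟩ := Val.mem_of_condition hv (hcond c hc hc')
      exact (key ζ ε h1 h2 ((hNN ζ h1).2 (els_of_val hlam hlam' (isoFun_mem h hc)
        (hcond c hc hc') hv).2.1)).1 hv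
    · intro hv
      obtain ⟨-, h1, h2⟩ := Val.mem_of_condition hv hc'
      exact (key ζ ε h1 h2 (els_of_val hlam hlam' hc hc' hv).2.1).2 hv
  · intro c hc hc' v f hvf
    obtain ⟨h1, h2⟩ := els_of_prm hlam hlam' (isoFun_mem h hc) (hcond c hc hc') hvf
    exact ⟨exists_isoFun_eq h h1, fun ξ hξ => hpre ξ (h2 ξ hξ)
      ((Prm.isPromise (hcond c hc hc') hvf).1 hξ)⟩
  · intro p hp r hr e he he'
    have hD : Def fun v : ℕ → H lam => ∃ e : ZFSet.{u}, ZFSet.pair e (v 1).1 ∈ (v 0).1 ∧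
        ZFSet.pair e (v 2).1 ∈ (v 0).1 :=
      Def.exZ ((Def.pair_mem hl _ _ _).and (Def.pair_mem hl _ _ _))
        fun v e he => H_of_pair_left (H_of_mem (v 0).2 he.1)
    have := isoFun_iff h (T := fun R p r _ => ∃ e, ZFSet.pair e p ∈ R ∧ ZFSet.pair e r ∈ R)
      hD hrel hp hr hr
    rw [hrelfix] at this
    exact this.1 ⟨e, he, he'⟩

end Submodel

/-! ### The properness isomorphism condition -/

theorem forces_mem_of_ext {P : ForcingNotion.{u}} {q r : ZFSet.{u}} (h : P.Ext q r) :
    Forces P q (.mem r) :=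
  fun s hs => ⟨s, P.refl s (mem_carrier_of_ext hs).1, P.trans _ _ _ hs h⟩

/-- If every extension of `q` compatible with `r` extends `r'`, then `q` forces
`r ∈ G → r' ∈ G`. -/
theorem forces_neg_and_neg {P : ForcingNotion.{u}} {q r r' : ZFSet.{u}}
    (h : ∀ t, P.Ext t q → P.Ext t r → P.Ext t r') :
    Forces P q (.neg (.and (.mem r) (.neg (.mem r')))) := by
  rintro s hs ⟨h1, h2⟩
  obtain ⟨t, hts, htr⟩ := h1 s (P.refl s (mem_carrier_of_ext hs).1)
  exact h2 t hts (forces_mem_of_ext (h t (P.trans _ _ _ hts hs) htr))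

end PIC

theorem mainTheorem5 (hCH : Cardinal.continuum.{u} = ℵ_ 1) (κ : Ordinal.{u})
    (I : ZFSet.{u} → ZFSet.{u}) (A : ZFSet.{u} → ZFSet.{u} → ZFSet.{u})
    (hI : ∀ ξ ∈ κ.toZFSet, PIC.IsPIdeal (I ξ))
    (hA : ∀ ξ ∈ κ.toZFSet, PIC.IsGeneratingSequence (I ξ) (A ξ)) :
    PIC.SatisfiesAleph2PIC (PIC.idealForcing κ I A) := by
  open PIC in
  obtain ⟨μ₁, h₁⟩ := exists_forall_mem_H (om1.prod (conditions κ I))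
  obtain ⟨μ₂, h₂⟩ := exists_forall_mem_H (om1 : ZFSet.{u})
  obtain ⟨μ₃, h₃⟩ := exists_forall_mem_H (κ.toZFSet.prod om1)
  refine ⟨max (max μ₁ μ₂) (max μ₃ (ℵ_ 1)), fun lam hle hlam => ?_⟩
  simp only [max_le_iff] at hle
  have hH := h₁ lam hle.1.1
  have hom := h₂ lam hle.1.2
  have hκ := h₃ lam hle.2.1
  have hlam' : ℵ₀ < lam := Cardinal.aleph0_lt_aleph_one.trans_le hle.2.2
  have hl := hlam.aleph0_le
  intro i j Ni Nj h p hij hj hNi hNj hi hj' hNij hNN hhi hfix hPi hPj hp hp'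
  obtain ⟨hCi, hreli⟩ := Submodel.els_of_pair hl hPi
  obtain ⟨hCj, hrelj⟩ := Submodel.els_of_pair hl hPj
  have homi : om1 ∈ Ni.els := Submodel.om1_mem_els hl hI hA hom hCi
  have homj : om1 ∈ Nj.els := Submodel.om1_mem_els hl hI hA hom hCj
  -- As an element of `N_i` below `ω₂`, the ordinal `ω₁` is below `j`; being also in `N_j`, it
  -- belongs to `N_j ∩ j = N_i ∩ i`. Hence the two models have the same countable ordinals.
  have hω : ω_ 1 < j := hNij _ (by simp) homi
  have hωi : ω_ 1 < i := ((hNN _).2 ⟨homj, hω⟩).2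
  have hNN' : ∀ α ∈ om1, α ∈ Ni.els ↔ α ∈ Nj.els := fun α hα => by
    obtain ⟨a, ha, rfl⟩ := mem_om1.1 hα
    exact ⟨fun h => ((hNN a).1 ⟨h, ha.trans hωi⟩).1, fun h => ((hNN a).2 ⟨h, ha.trans hω⟩).1⟩
  have T := Submodel.twin hCH hI hA hlam hlam' hH hom hκ hNi hCi hreli hCj hrelj h hfix hNN'
  obtain ⟨q, hq, hqp, hqD⟩ := T.exists_generic hI hA hp hp'
  refine ⟨q, hq, fun r => ?_, forces_mem_of_ext hqp, fun D hD hD' s hs hall => ?_⟩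
  · obtain ⟨⟨r, hrN⟩, hrC⟩ := r
    have hr : Submodel.val (⟨r, hrN⟩ : Ni) ∈ Ni.els := Submodel.val_mem_els _
    obtain ⟨D, hD, hDd, hdec⟩ := T.decide _ hr hrC
    obtain ⟨d, hdD, hdN, hqd, hqd'⟩ := hqD D hD hDd
    have hσ := Submodel.isoFun_val h ⟨r, hrN⟩
    -- If `d` extends `r`, then `q` extends both `r` and `h r`. Otherwise `d` is incompatible with
    -- `r`, so by elementarity the image of `d` is incompatible with `h r`, and both implications
    -- hold vacuously below `q`.
    rcases hdec d hdD with hd | hd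
    · have hd' := T.ext _ hr d hdN hd
      rw [hσ] at hd'
      exact ⟨forces_neg_and_neg fun t ht _ => (idealForcing κ I A).trans _ _ _ ht
          ((idealForcing κ I A).trans _ _ _ hqd' hd'),
        forces_neg_and_neg fun t ht _ => (idealForcing κ I A).trans _ _ _ ht
          ((idealForcing κ I A).trans _ _ _ hqd hd)⟩
    · refine ⟨forces_neg_and_neg fun t ht htr => ?_, forces_neg_and_neg fun t ht htr => ?_⟩
      · exact absurd htr (hd t ((idealForcing κ I A).trans _ _ _ ht hqd))
      · rw [← hσ] at htr
        obtain ⟨e, he, he'⟩ := T.compat d hdN _ hr t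
          ((idealForcing κ I A).trans _ _ _ ht hqd') htr
        exact absurd he' (hd e he)
  · obtain ⟨d, hdD, hdN, hqd, -⟩ := hqD D hD hD'
    exact hall ⟨d, hdD, hdN⟩ s ((idealForcing κ I A).refl s (mem_carrier_of_ext hs).1)
      (forces_mem_of_ext ((idealForcing κ I A).trans _ _ _ hs hqd))
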